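/- For $n\ge 0$ let $e_1,\dots,e_n$ be the standard basis of $\mathbb R^n$ and consider the positive roots of the classical root systems $$A_{n-1}^+=\{e_i-e_j: 1\le i<j\le n\},\qquad D_n^+=\{e_i-e_j,\ e_i+e_j: 1\le i<j\le n\},$$ $$B_n^+=D_n^+\cup\{e_i:1\le i\le n\},\qquad C_n^+=D_n^+\cup\{2e_i:1\le i\le n\}.$$ For $\Phi\in\{A_{n-1},B_n,C_n,D_n\}$ let $\Pi^{\mathbb Z}(\Phi)=\sum_{\alpha\in\Phi^+}[0,\alpha]\subset\mathbb R^n$ (Minkowski sum of segments, equal to $\{0\}$ if $\Phi^+=\emptyset$) be the integral Coxeter permutahedron. There is a unique polynomial $\mathrm{ehr}_{\Pi^{\mathbb Z}(\Phi)}\in\mathbb Q[t]$, the Ehrhart polynomial, with $\mathrm{ehr}_{\Pi^{\mathbb Z}(\Phi)}(t)=|t\,\Pi^{\mathbb Z}(\Phi)\cap\mathbb Z^n|$ for every positive integer $t$. Let $W(x)=\sum_{n\ge1}(-n)^{n-1}\frac{x^n}{n!}$ be the Lambert $W$ function. Then, for every rational number $t\neq0$ (in particular for every positive integer $t$), the following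 identities of formal power series in $x$ over $\mathbb Q$ hold, where $\sqrt{1+f}$ denotes the square root with constant term $1$: $$\sum_{n\ge0}\mathrm{ehr}_{\Pi^{\mathbb Z}(A_{n-1})}(t)\frac{x^n}{n!}=\exp\Big(-\frac1tW(-tx)-\frac1{2t}W(-tx)^2\Big),$$ $$\sum_{n\ge0}\mathrm{ehr}_{\Pi^{\mathbb Z}(B_n)}(t)\frac{x^n}{n!}=\frac{\exp\big(-\frac1{2t}W(-2tx)-\frac1{4t}W(-2tx)^2\big)}{\sqrt{1+W(-2tx)}},$$ $$\sum_{n\ge0}\mathrm{ehr}_{\Pi^{\mathbb Z}(C_n)}(t)\frac{x^n}{n!}=\frac{\exp\big(\frac{-t-1}{2t}W(-2tx)-\frac1{4t}W(-2tx)^2\big)}{\sqrt{1+W(-2tx)}},$$ $$\sum_{n\ge0}\mathrm{ehr}_{\Pi^{\mathbb Z}(D_n)}(t)\frac{x^n}{n!}=\frac{\exp\big(\frac{t-1}{2t}W(-2tx)-\frac1{4t}W(-2tx)^2\big)}{\sqrt{1+W(-2tx)}}.$$ -/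

import Mathlib

open scoped Pointwise Nat

/-! ## Positive roots of the classical root systems, as vectors in `ℤ ^ n` -/

/-- Positive roots of `A_{n-1}`: the vectors `e_i - e_j` with `i < j`. -/
def positiveRootsA (n : ℕ) : Finset (Fin n → ℤ) :=
  ((Finset.univ : Finset (Fin n × Fin n)).filter fun p => p.1 < p.2).image
    fun p => Pi.single p.1 1 - Pi.single p.2 1

/-- Positive roots of `D_n`: the vectors `e_i - e_j` and `e_i + e_j` with `i < j`. -/
def positiveRootsD (n : ℕ) : Finset (Fin n → ℤ) :=
  positiveRootsA n ∪
    ((Finset.univ : Finset (Fin n × Fin n)).filter fun p => p.1 < p.2).image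
      fun p => Pi.single p.1 1 + Pi.single p.2 1

/-- Positive roots of `B_n`: those of `D_n` together with the vectors `e_i`. -/
def positiveRootsB (n : ℕ) : Finset (Fin n → ℤ) :=
  positiveRootsD n ∪ (Finset.univ : Finset (Fin n)).image fun i => Pi.single i 1

/-- Positive roots of `C_n`: those of `D_n` together with the vectors `2 e_i`. -/
def positiveRootsC (n : ℕ) : Finset (Fin n → ℤ) :=
  positiveRootsD n ∪ (Finset.univ : Finset (Fin n)).image fun i => Pi.single i 2

/-! ## Integral Coxeter permutahedra and Ehrhart polynomials -/

/-- The inclusion of `ℤ ^ n` in `ℝ ^ n`. -/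
def intVec {n : ℕ} (z : Fin n → ℤ) : Fin n → ℝ := fun i => (z i : ℝ)

/-- The integral Coxeter permutahedron with positive roots `Φ`: the Minkowski sum of the segments
`[0, α]` over `α ∈ Φ` (the single point `0` when `Φ` is empty). -/
noncomputable def integralCoxeterPermutahedron {n : ℕ} (Φ : Finset (Fin n → ℤ)) :
    Set (Fin n → ℝ) :=
  ∑ α ∈ Φ, segment ℝ 0 (intVec α)

/-- The lattice points of the dilate `t P`. -/
def dilateLatticePoints {n : ℕ} (P : Set (Fin n → ℝ)) (t : ℕ) : Set (Fin n → ℤ) :=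
  {z | intVec z ∈ (t : ℝ) • P}

/-- `p` is the Ehrhart polynomial of `P`: for every positive integer `t`, the dilate `t P` contains
exactly `p(t)` lattice points. Such a `p` is unique, having prescribed values at infinitely many
arguments. -/
def IsEhrhartPolynomial {n : ℕ} (P : Set (Fin n → ℝ)) (p : Polynomial ℚ) : Prop :=
  ∀ t : ℕ, 0 < t →
    (dilateLatticePoints P t).Finite ∧ ((dilateLatticePoints P t).ncard : ℚ) = p.eval (t : ℚ)

/-! ## Formal power series in `x` over `ℚ` -/

/-- The Lambert function `W(x) = ∑_{n ≥ 1} (-n)^(n-1) x^n / n!`. -/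
noncomputable def lambertW : PowerSeries ℚ :=
  PowerSeries.mk fun n => if n = 0 then 0 else (-(n : ℚ)) ^ (n - 1) / (n ! : ℚ)

/-- `W(c x)` for a scalar `c`. -/
noncomputable def lambertWScaled (c : ℚ) : PowerSeries ℚ :=
  PowerSeries.rescale c lambertW

/-- `exp(f)` for a power series `f` without constant term. -/
noncomputable def expSeries (f : PowerSeries ℚ) : PowerSeries ℚ :=
  (PowerSeries.exp ℚ).subst f

/-- `√(1 + f)` for a power series `f` without constant term: Newton's binomial series
`∑ₖ (1/2 choose k) f^k`. -/
noncomputable def sqrtOneAdd (f : PowerSeries ℚ) : PowerSeries ℚ :=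
  (PowerSeries.binomialSeries ℚ (1 / 2 : ℚ)).subst f

/-- `sqrtOneAdd f` is indeed a square root of `1 + f`. -/
theorem sqrtOneAdd_sq (f : PowerSeries ℚ) (hf : PowerSeries.constantCoeff f = 0) :
    sqrtOneAdd f ^ 2 = 1 + f := by
  have h : PowerSeries.HasSubst f := PowerSeries.HasSubst.of_constantCoeff_zero' hf
  have key : PowerSeries.binomialSeries ℚ (1 / 2 : ℚ) ^ 2 = 1 + PowerSeries.X := by
    rw [sq, ← PowerSeries.binomialSeries_add]
    have := PowerSeries.binomialSeries_nat (R := ℚ) (A := ℚ) 1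
    norm_num at this ⊢
    exact this
  rw [sqrtOneAdd, ← PowerSeries.subst_pow h, key, PowerSeries.subst_add h, PowerSeries.subst_X h,
    ← PowerSeries.coe_substAlgHom h, map_one]

/-- The exponential generating function `∑_{n ≥ 0} p_n(t) x^n / n!` of a sequence of polynomials
`p_n`, evaluated at a number `t`. -/
noncomputable def egfAt (p : ℕ → Polynomial ℚ) (t : ℚ) : PowerSeries ℚ :=
  PowerSeries.mk fun n => (p n).eval t / (n ! : ℚ)

/-!
Identify convex bodies which differ by a lattice translation. If a lattice vector `β` has an entry
equal to `1`, adding the segment `[0, β]` to a body gains exactly one lattice point on each line of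
direction `β` that meets the body. Hence lattice point counts satisfy the deletion–contraction rule
`|P + [0, β]| = |P| + |P / β|`, where `P / β` is the projection of `P` along `β`.

Apply the rule to all the segments which involve one coordinate `s`. The count for the roots on
`m + 1` coordinates becomes a sum over the sets `S` of coordinates that are merged into `s`, and
merging yields a body of the same kind on fewer coordinates, with other multiplicities of the
segments at `s`. This recursion is polynomial in the dilation factor `t`. The tree function
`q = -W(-t x) / t` satisfies `q = x exp(t q)`, so that `exp(c q) = exp(c x exp(t q))` expands into
the same sum over `S`; it remains to compare derivatives in `x`, which account for `S = ∅`.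
-/

/-! ## Lattice points of convex bodies, up to lattice translation -/

section LatticePoints

variable {n : ℕ}

theorem intVec_zero : intVec (0 : Fin n → ℤ) = 0 := by
  ext; simp [intVec]

theorem intVec_add (x y : Fin n → ℤ) : intVec (x + y) = intVec x + intVec y := by
  ext; simp [intVec]

theorem intVec_sub (x y : Fin n → ℤ) : intVec (x - y) = intVec x - intVec y := by
  ext; simp [intVec]

theorem intVec_neg (x : Fin n → ℤ) : intVec (-x) = -intVec x := by
  ext; simp [intVec]

theorem intVec_smul (k : ℤ) (x : Fin n → ℤ) : intVec (k • x) = (k : ℝ) • intVec x := by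
  ext; simp [intVec]

theorem intVec_single (i : Fin n) (k : ℤ) : intVec (Pi.single i k) = Pi.single i (k : ℝ) := by
  ext j; simp [intVec, Pi.single_apply]

theorem intVec_injective : Function.Injective (intVec (n := n)) :=
  Int.cast_injective.comp_left

theorem finite_intVec_preimage {P : Set (Fin n → ℝ)} (hP : Bornology.IsBounded P) :
    (intVec ⁻¹' P).Finite := by
  obtain ⟨r, hr⟩ := hP.subset_closedBall 0
  refine (Set.Finite.pi' (t := fun _ : Fin n => Set.Icc (-⌈r⌉) ⌈r⌉)
    fun _ => Set.finite_Icc _ _).subset fun z hz i => ?_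
  have hnorm : ‖intVec z‖ ≤ r := mem_closedBall_zero_iff.1 (hr hz)
  have habs : |(z i : ℝ)| ≤ ⌈r⌉ :=
    ((norm_le_pi_norm (intVec z) i).trans hnorm).trans (Int.le_ceil r)
  exact abs_le.1 (by exact_mod_cast habs)

/-- The finite set of lattice points of a convex body. -/
noncomputable def latticePoints (P : ConvexBody (Fin n → ℝ)) : Finset (Fin n → ℤ) :=
  (finite_intVec_preimage P.isBounded).toFinset

theorem mem_latticePoints {P : ConvexBody (Fin n → ℝ)} {z : Fin n → ℤ} :
    z ∈ latticePoints P ↔ intVec z ∈ P :=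
  Set.Finite.mem_toFinset _

theorem card_latticePoints_translate {P Q : ConvexBody (Fin n → ℝ)} {z : Fin n → ℤ}
    (h : (P : Set (Fin n → ℝ)) = {intVec z} + (Q : Set (Fin n → ℝ))) :
    (latticePoints P).card = (latticePoints Q).card := by
  suffices latticePoints P = (latticePoints Q).map (addLeftEmbedding z) by
    rw [this, Finset.card_map]
  ext y
  have hy : intVec y ∈ P ↔ intVec (y - z) ∈ Q := by
    rw [← SetLike.mem_coe, h, Set.singleton_add, Set.mem_image]
    exact ⟨fun ⟨p, hp, hpy⟩ => by rwa [intVec_sub, ← hpy, add_sub_cancel_left],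
      fun hyz => ⟨_, hyz, by rw [intVec_sub, add_sub_cancel]⟩⟩
  simp only [Finset.mem_map, mem_latticePoints, hy, addLeftEmbedding_apply]
  exact ⟨fun hyz => ⟨_, hyz, add_sub_cancel z y⟩, by rintro ⟨x, hx, rfl⟩; rwa [add_sub_cancel_left]⟩

/-- The congruence on convex bodies which identifies a body with its lattice translates. -/
def latticeTranslationCon (n : ℕ) : AddCon (ConvexBody (Fin n → ℝ)) where
  r P Q := ∃ z : Fin n → ℤ, (P : Set (Fin n → ℝ)) = {intVec z} + (Q : Set (Fin n → ℝ))
  iseqv :=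
    { refl := fun P => ⟨0, by rw [intVec_zero, Set.singleton_zero, zero_add]⟩
      symm := by
        rintro P Q ⟨z, h⟩
        exact ⟨-z, by rw [h, ← add_assoc, Set.singleton_add_singleton, ← intVec_add,
          neg_add_cancel, intVec_zero, Set.singleton_zero, zero_add]⟩
      trans := by
        rintro P Q R ⟨z, h⟩ ⟨z', h'⟩
        exact ⟨z + z', by rw [h, h', ← add_assoc, Set.singleton_add_singleton, ← intVec_add]⟩ }
  add' := by
    rintro P P' Q Q' ⟨z, h⟩ ⟨z', h'⟩
    exact ⟨z + z', by
      rw [ConvexBody.coe_add, ConvexBody.coe_add, h, h', intVec_add, ← Set.singleton_add_singleton,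
        add_add_add_comm]⟩

/-- Convex bodies modulo lattice translation, a commutative monoid under Minkowski addition.
Passing to classes makes `[0, -v]` equal to `[0, v]`. -/
def BodyClass (n : ℕ) : Type := (latticeTranslationCon n).Quotient

noncomputable instance (n : ℕ) : AddCommMonoid (BodyClass n) :=
  inferInstanceAs (AddCommMonoid (latticeTranslationCon n).Quotient)

/-- The class of a convex body modulo lattice translation. -/
noncomputable def bodyClass : ConvexBody (Fin n → ℝ) →+ BodyClass n :=
  (latticeTranslationCon n).mk'

theorem bodyClass_eq_iff {P Q : ConvexBody (Fin n → ℝ)} :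
    bodyClass P = bodyClass Q ↔
      ∃ z : Fin n → ℤ, (P : Set (Fin n → ℝ)) = {intVec z} + (Q : Set (Fin n → ℝ)) :=
  (latticeTranslationCon n).eq

theorem bodyClass_surjective : Function.Surjective (bodyClass (n := n)) :=
  AddCon.mk'_surjective

/-- The number of lattice points of any convex body in the given class. -/
noncomputable def latticeCount (p : BodyClass n) : ℕ :=
  AddCon.liftOn p (fun P => (latticePoints P).card) fun _ _ ⟨_, h⟩ =>
    card_latticePoints_translate h

theorem latticeCount_bodyClass (P : ConvexBody (Fin n → ℝ)) :
    latticeCount (bodyClass P) = (latticePoints P).card := rfl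

theorem latticeCount_zero : latticeCount (0 : BodyClass n) = 1 := by
  rw [← map_zero bodyClass, latticeCount_bodyClass, Finset.card_eq_one]
  refine ⟨0, Finset.ext fun z => ?_⟩
  rw [mem_latticePoints, ← SetLike.mem_coe, ConvexBody.coe_zero, Set.mem_zero,
    Finset.mem_singleton, ← intVec_zero, intVec_injective.eq_iff]

end LatticePoints

section Segments

variable {n : ℕ}

/-- The segment from the origin to a lattice point, as a convex body. -/
def segBody (v : Fin n → ℤ) : ConvexBody (Fin n → ℝ) where
  carrier := segment ℝ 0 (intVec v)
  convex' := convex_segment _ _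
  isCompact' := by
    rw [segment_eq_image]
    exact isCompact_Icc.image (by fun_prop)
  nonempty' := ⟨0, left_mem_segment _ _ _⟩

theorem coe_segBody (v : Fin n → ℤ) :
    (segBody v : Set (Fin n → ℝ)) = segment ℝ 0 (intVec v) := rfl

theorem segBody_zero : segBody (0 : Fin n → ℤ) = 0 := by
  apply ConvexBody.ext
  rw [coe_segBody, intVec_zero, segment_same, ConvexBody.coe_zero, Set.singleton_zero]

/-- The class of the segment from the origin to a lattice point. -/
noncomputable def seg (v : Fin n → ℤ) : BodyClass n := bodyClass (segBody v)

theorem seg_zero : seg (0 : Fin n → ℤ) = 0 := by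
  rw [seg, segBody_zero, map_zero]

theorem seg_neg (v : Fin n → ℤ) : seg (-v) = seg v := by
  refine bodyClass_eq_iff.2 ⟨-v, ?_⟩
  rw [coe_segBody, coe_segBody, Set.singleton_add, segment_translate_image, add_zero, intVec_neg,
    neg_add_cancel, segment_symm]

theorem seg_two_smul (v : Fin n → ℤ) : seg ((2 : ℤ) • v) = 2 • seg v := by
  rw [seg, seg, ← map_nsmul]
  congr 1
  apply ConvexBody.ext
  have hadd := Convex.add_smul (segBody v).convex (zero_le_one (α := ℝ)) zero_le_one
  have himage := image_segment ℝ (LinearMap.lsmul ℝ (Fin n → ℝ) 2).toAffineMap 0 (intVec v)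
  rw [two_nsmul, ConvexBody.coe_add, coe_segBody, coe_segBody, intVec_smul]
  simp only [one_smul, one_add_one_eq_two, coe_segBody] at hadd
  rw [← hadd, ← Set.image_smul]
  push_cast
  rw [LinearMap.coe_toAffineMap, map_zero] at himage
  exact himage.symm

end Segments

section IntegralMaps

variable {l m n : ℕ}

/-- The extension of an integral linear map to the real vector spaces spanned by the lattices. -/
noncomputable def realExtension (f : (Fin m → ℤ) →ₗ[ℤ] (Fin n → ℤ)) :
    (Fin m → ℝ) →ₗ[ℝ] (Fin n → ℝ) :=
  Fintype.linearCombination ℝ fun j => intVec (f (Pi.single j 1))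

theorem realExtension_intVec (f : (Fin m → ℤ) →ₗ[ℤ] (Fin n → ℤ)) (v : Fin m → ℤ) :
    realExtension f (intVec v) = intVec (f v) := by
  have hf : f v = ∑ j, v j • f (Pi.single j 1) := by
    simp only [← map_smul, ← map_sum, ← Pi.single_smul, smul_eq_mul, mul_one,
      Finset.univ_sum_single]
  ext i
  simp [realExtension, hf, Fintype.linearCombination_apply, intVec]

theorem realExtension_eq {f : (Fin m → ℤ) →ₗ[ℤ] (Fin n → ℤ)} {g : (Fin m → ℝ) →ₗ[ℝ] (Fin n → ℝ)}
    (h : ∀ v, g (intVec v) = intVec (f v)) : realExtension f = g := by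
  refine LinearMap.pi_ext' fun j => LinearMap.ext_ring ?_
  have hj : (Pi.single j 1 : Fin m → ℝ) = intVec (Pi.single j 1) := by
    rw [intVec_single, Int.cast_one]
  rw [LinearMap.comp_apply, LinearMap.comp_apply, LinearMap.single_apply, hj, h,
    realExtension_intVec]

theorem realExtension_comp (g : (Fin m → ℤ) →ₗ[ℤ] (Fin n → ℤ))
    (f : (Fin l → ℤ) →ₗ[ℤ] (Fin m → ℤ)) :
    realExtension (g ∘ₗ f) = realExtension g ∘ₗ realExtension f :=
  realExtension_eq fun v => by
    rw [LinearMap.comp_apply, LinearMap.comp_apply, realExtension_intVec, realExtension_intVec]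

/-- The image of a convex body under an integral linear map. -/
noncomputable def mapBody (f : (Fin m → ℤ) →ₗ[ℤ] (Fin n → ℤ)) :
    ConvexBody (Fin m → ℝ) →+ ConvexBody (Fin n → ℝ) where
  toFun P :=
    { carrier := realExtension f '' P
      convex' := P.convex.linear_image _
      isCompact' := P.isCompact.image (LinearMap.continuous_of_finiteDimensional _)
      nonempty' := P.nonempty.image _ }
  map_zero' := ConvexBody.ext (by
    change realExtension f '' (0 : Set (Fin m → ℝ)) = 0
    rw [Set.image_zero, map_zero, Set.singleton_zero])
  map_add' P Q := ConvexBody.ext (Set.image_add _)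

theorem coe_mapBody (f : (Fin m → ℤ) →ₗ[ℤ] (Fin n → ℤ)) (P : ConvexBody (Fin m → ℝ)) :
    (mapBody f P : Set (Fin n → ℝ)) = realExtension f '' P := rfl

theorem mapBody_segBody (f : (Fin m → ℤ) →ₗ[ℤ] (Fin n → ℤ)) (v : Fin m → ℤ) :
    mapBody f (segBody v) = segBody (f v) := by
  apply ConvexBody.ext
  have himage := image_segment ℝ (realExtension f).toAffineMap 0 (intVec v)
  rw [coe_mapBody, coe_segBody, coe_segBody, ← realExtension_intVec]
  rwa [LinearMap.coe_toAffineMap, map_zero] at himage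

/-- The action of an integral linear map on classes of convex bodies. -/
noncomputable def mapClass (f : (Fin m → ℤ) →ₗ[ℤ] (Fin n → ℤ)) : BodyClass m →+ BodyClass n :=
  (latticeTranslationCon m).lift (bodyClass.comp (mapBody f)) (by
    rintro P Q ⟨z, h⟩
    refine bodyClass_eq_iff.2 ⟨f z, ?_⟩
    rw [coe_mapBody, coe_mapBody, h, Set.image_add, Set.image_singleton, realExtension_intVec])

theorem mapClass_bodyClass (f : (Fin m → ℤ) →ₗ[ℤ] (Fin n → ℤ)) (P : ConvexBody (Fin m → ℝ)) :
    mapClass f (bodyClass P) = bodyClass (mapBody f P) := rfl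

theorem mapClass_seg (f : (Fin m → ℤ) →ₗ[ℤ] (Fin n → ℤ)) (v : Fin m → ℤ) :
    mapClass f (seg v) = seg (f v) := by
  rw [seg, mapClass_bodyClass, mapBody_segBody, seg]

theorem mapClass_id (p : BodyClass n) : mapClass LinearMap.id p = p := by
  obtain ⟨P, rfl⟩ := bodyClass_surjective p
  rw [mapClass_bodyClass]
  congr 1
  apply ConvexBody.ext
  rw [coe_mapBody, realExtension_eq (g := LinearMap.id) fun v => rfl, LinearMap.id_coe,
    Set.image_id]

theorem mapClass_comp (g : (Fin m → ℤ) →ₗ[ℤ] (Fin n → ℤ)) (f : (Fin l → ℤ) →ₗ[ℤ] (Fin m → ℤ))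
    (p : BodyClass l) : mapClass (g ∘ₗ f) p = mapClass g (mapClass f p) := by
  obtain ⟨P, rfl⟩ := bodyClass_surjective p
  rw [mapClass_bodyClass, mapClass_bodyClass, mapClass_bodyClass]
  congr 1
  apply ConvexBody.ext
  rw [coe_mapBody, coe_mapBody, coe_mapBody, Set.image_image, realExtension_comp]
  rfl

end IntegralMaps

/-! ## Deletion and contraction of a segment -/

section DeletionContraction

variable {n : ℕ}

/-- The projection `x ↦ x - x i • β`, whose fibres are lines of direction `β` when `β i = 1`. -/
def contractAlong (i : Fin n) (β : Fin n → ℤ) : (Fin n → ℤ) →ₗ[ℤ] (Fin n → ℤ) :=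
  LinearMap.id - (LinearMap.proj i).smulRight β

theorem contractAlong_apply (i : Fin n) (β x : Fin n → ℤ) :
    contractAlong i β x = x - x i • β := rfl

theorem realExtension_contractAlong (i : Fin n) (β : Fin n → ℤ) (x : Fin n → ℝ) :
    realExtension (contractAlong i β) x = x - x i • intVec β := by
  have h : realExtension (contractAlong i β) =
      LinearMap.id - (LinearMap.proj i).smulRight (intVec β) :=
    realExtension_eq fun v => by rw [contractAlong_apply, intVec_sub, intVec_smul]; rfl
  rw [h]
  rfl

theorem exists_line_mem_iff_mem_Icc (P : ConvexBody (Fin n → ℝ)) (q : Fin n → ℝ)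
    {v : Fin n → ℝ} (hv : v ≠ 0) (hne : ∃ r : ℝ, q + r • v ∈ P) :
    ∃ a b : ℝ, a ≤ b ∧ ∀ r : ℝ, q + r • v ∈ P ↔ r ∈ Set.Icc a b := by
  have hembed :=
    (Homeomorph.addLeft q).isClosedEmbedding.comp (isClosedEmbedding_smul_left (𝕜 := ℝ) hv)
  set K : Set ℝ := {r | q + r • v ∈ P}
  have hcomp : IsCompact K := hembed.isCompact_preimage P.isCompact
  have hconv : Convex ℝ K :=
    (P.convex.translate_preimage_right q).linear_preimage (LinearMap.toSpanSingleton ℝ _ v)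
  refine ⟨sInf K, sSup K, Real.sInf_le_sSup K hcomp.bddBelow hcomp.bddAbove, fun r => ?_⟩
  have hK : K = Set.Icc (sInf K) (sSup K) :=
    eq_Icc_of_connected_compact ⟨hne, hconv.isPreconnected⟩ hcomp
  rw [← hK]
  rfl

theorem line_mem_add_segment_iff {P : Set (Fin n → ℝ)} {q v : Fin n → ℝ} {a b : ℝ} (hab : a ≤ b)
    (h : ∀ r : ℝ, q + r • v ∈ P ↔ r ∈ Set.Icc a b) (r : ℝ) :
    q + r • v ∈ P + segment ℝ 0 v ↔ r ∈ Set.Icc a (b + 1) := by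
  simp only [Set.mem_add, segment_eq_image, smul_zero, zero_add, Set.mem_image]
  constructor
  · rintro ⟨x, hx, _, ⟨c, hc, rfl⟩, hxy⟩
    have hx' : x = q + (r - c) • v := by rw [eq_sub_of_add_eq hxy]; module
    rw [hx', h] at hx
    exact ⟨by linarith [hx.1, hc.1], by linarith [hx.2, hc.2]⟩
  · rintro ⟨har, hrb⟩
    refine ⟨q + (min r b) • v, (h _).2 ⟨le_min har hab, min_le_right _ _⟩, _,
      ⟨r - min r b, ⟨by simp, ?_⟩, rfl⟩, by module⟩
    rcases min_choice r b with h | h <;> rw [h] <;> linarith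

theorem card_filter_contractAlong (S : Finset (Fin n → ℤ)) {i : Fin n} {β q : Fin n → ℤ}
    (hβ : β i = 1) (hq : q i = 0) {a b : ℝ}
    (h : ∀ r : ℤ, q + r • β ∈ S ↔ (r : ℝ) ∈ Set.Icc a b) :
    (S.filter fun z => contractAlong i β z = q).card = (Finset.Icc ⌈a⌉ ⌊b⌋).card := by
  have hIcc (r : ℤ) : q + r • β ∈ S ↔ r ∈ Finset.Icc ⌈a⌉ ⌊b⌋ := by
    rw [h, Set.mem_Icc, Finset.mem_Icc, Int.ceil_le, Int.le_floor]
  have hline {z : Fin n → ℤ} (hz : contractAlong i β z = q) : q + z i • β = z := by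
    rw [← hz, contractAlong_apply, sub_add_cancel]
  refine Finset.card_bij' (fun z _ => z i) (fun r _ => q + r • β) ?_ ?_ ?_ ?_
  · intro z hz
    rw [Finset.mem_filter] at hz
    rw [← hIcc, hline hz.2]
    exact hz.1
  · intro r hr
    rw [Finset.mem_filter, hIcc]
    exact ⟨hr, by simp [contractAlong_apply, hβ, hq]⟩
  · intro z hz
    exact hline (Finset.mem_filter.1 hz).2
  · intro r _
    simp [hβ, hq]

theorem card_Icc_ceil_floor_add_one {a b : ℝ} (hab : a ≤ b) :
    (Finset.Icc ⌈a⌉ ⌊b + 1⌋).card = (Finset.Icc ⌈a⌉ ⌊b⌋).card + 1 := by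
  have hle : ⌈a⌉ ≤ ⌊b⌋ + 1 := (Int.ceil_mono hab).trans (Int.ceil_le_floor_add_one b)
  rw [Int.card_Icc, Int.card_Icc, Int.floor_add_one]
  omega

theorem contractAlong_mem_latticePoints_mapBody {P : ConvexBody (Fin n → ℝ)} (i : Fin n)
    (β : Fin n → ℤ) {z : Fin n → ℤ} (hz : z ∈ latticePoints P) :
    contractAlong i β z ∈ latticePoints (mapBody (contractAlong i β) P) := by
  rw [mem_latticePoints, ← realExtension_intVec]
  exact Set.mem_image_of_mem _ (mem_latticePoints.1 hz)

/-- On each line of direction `β` that meets `P`, adding `[0, β]` gains exactly one lattice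
point. -/
theorem card_latticePoints_add_segBody (P : ConvexBody (Fin n → ℝ)) {i : Fin n} {β : Fin n → ℤ}
    (hβ : β i = 1) :
    (latticePoints (P + segBody β)).card =
      (latticePoints P).card + (latticePoints (mapBody (contractAlong i β) P)).card := by
  have hβ' : intVec β i = 1 := by rw [intVec, hβ, Int.cast_one]
  have hβ0 : intVec β ≠ 0 := fun h => one_ne_zero (hβ'.symm.trans (congrFun h i))
  have hsame : mapBody (contractAlong i β) (P + segBody β) = mapBody (contractAlong i β) P := by
    rw [map_add, mapBody_segBody, contractAlong_apply, hβ, one_smul, sub_self, segBody_zero,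
      add_zero]
  have hfib : ∀ q ∈ latticePoints (mapBody (contractAlong i β) P),
      ((latticePoints (P + segBody β)).filter fun z => contractAlong i β z = q).card =
        ((latticePoints P).filter fun z => contractAlong i β z = q).card + 1 := by
    intro q hq
    obtain ⟨x, hx, hxq⟩ := mem_latticePoints.1 hq
    rw [realExtension_contractAlong] at hxq
    have hqi : q i = 0 := by
      have := congrFun hxq i
      simp only [Pi.sub_apply, Pi.smul_apply, hβ', smul_eq_mul, mul_one, sub_self] at this
      exact Int.cast_eq_zero.1 this.symm
    have hline (r : ℤ) : intVec (q + r • β) = intVec q + (r : ℝ) • intVec β := by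
      rw [intVec_add, intVec_smul]
    obtain ⟨a, b, hab, h⟩ := exists_line_mem_iff_mem_Icc P (intVec q) hβ0
      ⟨x i, by rwa [← hxq, sub_add_cancel]⟩
    rw [card_filter_contractAlong _ hβ hqi fun r => by
        rw [mem_latticePoints, hline, ← SetLike.mem_coe, ConvexBody.coe_add, coe_segBody,
          line_mem_add_segment_iff hab h],
      card_filter_contractAlong _ hβ hqi fun r => by rw [mem_latticePoints, hline, h],
      card_Icc_ceil_floor_add_one hab]
  rw [Finset.card_eq_sum_card_fiberwise fun z hz =>
      hsame ▸ contractAlong_mem_latticePoints_mapBody i β hz,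
    Finset.card_eq_sum_card_fiberwise fun z => contractAlong_mem_latticePoints_mapBody i β,
    Finset.sum_congr rfl hfib, Finset.sum_add_distrib, Finset.card_eq_sum_ones]

theorem latticeCount_add_seg (p : BodyClass n) {i : Fin n} {β : Fin n → ℤ} (hβ : β i = 1) :
    latticeCount (p + seg β) = latticeCount p + latticeCount (mapClass (contractAlong i β) p) := by
  obtain ⟨P, rfl⟩ := bodyClass_surjective p
  exact card_latticePoints_add_segBody P hβ

theorem mapClass_contractAlong_seg {i : Fin n} {β : Fin n → ℤ} (hβ : β i = 1) :
    mapClass (contractAlong i β) (seg β) = 0 := by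
  rw [mapClass_seg, contractAlong_apply, hβ, one_smul, sub_self, seg_zero]

theorem latticeCount_add_nsmul_seg (p : BodyClass n) {i : Fin n} {β : Fin n → ℤ}
    (hβ : β i = 1) (k : ℕ) :
    latticeCount (p + k • seg β) =
      latticeCount p + k * latticeCount (mapClass (contractAlong i β) p) := by
  induction k with
  | zero => simp
  | succ k ih =>
    rw [succ_nsmul, ← add_assoc, latticeCount_add_seg _ hβ, ih, map_add, map_nsmul,
      mapClass_contractAlong_seg hβ, smul_zero, add_zero]
    ring

end DeletionContraction

/-! ## Sums over pairs -/

section PairSum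

variable {ι M M' : Type*} [LinearOrder ι] [AddCommMonoid M] [AddCommMonoid M']

/-- The sum of a function over the pairs `j < i` of a finite set. -/
def pairSum (f : ι → ι → M) (A : Finset ι) : M :=
  ∑ i ∈ A, ∑ j ∈ A with j < i, f i j

theorem pairSum_empty (f : ι → ι → M) : pairSum f ∅ = 0 := rfl

theorem pairSum_congr {f g : ι → ι → M} {A : Finset ι}
    (h : ∀ i ∈ A, ∀ j ∈ A, j < i → f i j = g i j) : pairSum f A = pairSum g A :=
  Finset.sum_congr rfl fun i hi => Finset.sum_congr rfl fun j hj =>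
    h i hi j (Finset.mem_filter.1 hj).1 (Finset.mem_filter.1 hj).2

theorem map_pairSum (ψ : M →+ M') (f : ι → ι → M) (A : Finset ι) :
    ψ (pairSum f A) = pairSum (fun i j => ψ (f i j)) A := by
  simp only [pairSum, map_sum]

theorem pairSum_insert {f : ι → ι → M} (hf : ∀ i j, f i j = f j i) {A : Finset ι} {s : ι}
    (hs : s ∉ A) : pairSum f (insert s A) = pairSum f A + ∑ i ∈ A, f i s := by
  have hrow : ∀ i ∈ A, ∑ j ∈ insert s A with j < i, f i j
      = (∑ j ∈ A with j < i, f i j) + if s < i then f i s else 0 := by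
    intro i _
    rw [Finset.filter_insert]
    split_ifs
    · rw [Finset.sum_insert (by simp [hs]), add_comm]
    · rw [add_zero]
  have hlast : ∑ j ∈ insert s A with j < s, f s j = ∑ i ∈ A, if i < s then f i s else 0 := by
    rw [Finset.filter_insert, if_neg (lt_irrefl s), Finset.sum_filter]
    simp only [hf s]
  rw [pairSum, Finset.sum_insert hs, Finset.sum_congr rfl hrow, Finset.sum_add_distrib, hlast,
    add_left_comm, ← Finset.sum_add_distrib, pairSum]
  congr 1
  refine Finset.sum_congr rfl fun i hi => ?_
  rcases lt_or_gt_of_ne (ne_of_mem_of_not_mem hi hs) with h | h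
  · rw [if_pos h, if_neg h.not_gt, add_zero]
  · rw [if_pos h, if_neg h.not_gt, zero_add]

theorem pairSum_union {f : ι → ι → M} (hf : ∀ i j, f i j = f j i) {S T : Finset ι}
    (hST : Disjoint S T) :
    pairSum f (S ∪ T) = pairSum f S + pairSum f T + ∑ i ∈ S, ∑ j ∈ T, f i j := by
  induction S using Finset.induction_on with
  | empty => simp [pairSum_empty]
  | insert s S hs ih =>
    rw [Finset.disjoint_insert_left] at hST
    rw [Finset.insert_union, pairSum_insert hf (by simp [hs, hST.1]), ih hST.2,
      pairSum_insert hf hs, Finset.sum_insert hs, Finset.sum_union hST.2]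
    simp only [hf s]
    abel

theorem pairSum_const (c : M) (A : Finset ι) :
    pairSum (fun _ _ => c) A = (A.card.choose 2) • c := by
  induction A using Finset.induction_on with
  | empty => simp [pairSum_empty]
  | insert s S hs ih =>
    rw [pairSum_insert (fun _ _ => rfl) hs, ih, Finset.card_insert_of_notMem hs,
      Finset.sum_const, ← add_smul, Nat.choose_succ_succ' S.card 1, Nat.choose_one_right, add_comm]

theorem map_pairSum_collapse {f : ι → ι → M} (hf : ∀ i j, f i j = f j i) {A S : Finset ι}
    (hS : S ⊆ A) (ψ : M →+ M) (c : M) (d : ι → M)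
    (hc : ∀ i ∈ S, ∀ j ∈ S, i ≠ j → ψ (f i j) = c)
    (hd : ∀ i ∈ S, ∀ j ∈ A \ S, ψ (f i j) = d j)
    (hfix : ∀ i ∈ A \ S, ∀ j ∈ A \ S, ψ (f i j) = f i j) :
    ψ (pairSum f A) =
      pairSum f (A \ S) + S.card • ∑ j ∈ A \ S, d j + (S.card.choose 2) • c := by
  rw [← Finset.union_sdiff_of_subset hS, pairSum_union hf Finset.disjoint_sdiff, map_add, map_add,
    Finset.union_sdiff_of_subset hS, map_pairSum, map_pairSum,
    pairSum_congr (fun i hi j hj hij => hc i hi j hj hij.ne'), pairSum_const,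
    pairSum_congr (fun i hi j hj _ => hfix i hi j hj), map_sum,
    Finset.sum_congr rfl fun i hi => by
      rw [map_sum, Finset.sum_congr rfl fun j hj => hd i hi j hj], Finset.sum_const]
  abel

theorem map_sum_collapse {f : ι → M} {A S : Finset ι} (hS : S ⊆ A) (ψ : M →+ M) (c : M)
    (hc : ∀ i ∈ S, ψ (f i) = c) (hfix : ∀ i ∈ A \ S, ψ (f i) = f i) :
    ψ (∑ i ∈ A, f i) = ∑ i ∈ A \ S, f i + S.card • c := by
  rw [← Finset.sum_sdiff hS, map_add, map_sum, map_sum, Finset.sum_congr rfl hc,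
    Finset.sum_congr rfl hfix, Finset.sum_const]

end PairSum

/-! ## Deletion and contraction of a star -/

section Star

variable {n : ℕ} {A S : Finset (Fin n)} {s i j : Fin n}

/-- The standard basis vector `e_i` of the lattice. -/
def basisVec (i : Fin n) : Fin n → ℤ := Pi.single i 1

theorem basisVec_self (i : Fin n) : basisVec i i = 1 := Pi.single_eq_same i 1

theorem basisVec_of_ne (h : i ≠ j) : basisVec i j = 0 := Pi.single_eq_of_ne' h 1

theorem linearCombination_basisVec (g : Fin n → Fin n → ℤ) (j : Fin n) :
    Fintype.linearCombination ℤ g (basisVec j) = g j := by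
  rw [basisVec, Fintype.linearCombination_apply_single, one_smul]

theorem linearMap_ext_basisVec {f g : (Fin n → ℤ) →ₗ[ℤ] (Fin n → ℤ)}
    (h : ∀ j, f (basisVec j) = g (basisVec j)) : f = g :=
  LinearMap.pi_ext' fun j => LinearMap.ext_ring (h j)

/-- The linear map which identifies the coordinates in `S` with the coordinate `s`: it sends `e_i`
to `e_s` for `i ∈ S` and fixes the other basis vectors. -/
def mergeInto (S : Finset (Fin n)) (s : Fin n) : (Fin n → ℤ) →ₗ[ℤ] (Fin n → ℤ) :=
  Fintype.linearCombination ℤ fun j => if j ∈ S then basisVec s else basisVec j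

theorem mergeInto_basisVec_of_mem (h : j ∈ S) : mergeInto S s (basisVec j) = basisVec s := by
  rw [mergeInto, linearCombination_basisVec, if_pos h]

theorem mergeInto_basisVec_of_notMem (h : j ∉ S) : mergeInto S s (basisVec j) = basisVec j := by
  rw [mergeInto, linearCombination_basisVec, if_neg h]

theorem mergeInto_empty (s : Fin n) : mergeInto ∅ s = LinearMap.id :=
  linearMap_ext_basisVec fun j => mergeInto_basisVec_of_notMem (Finset.notMem_empty j)

theorem mergeInto_comp_mergeInto_singleton (hs : s ∉ S) :
    mergeInto S s ∘ₗ mergeInto {i} s = mergeInto (insert i S) s := by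
  refine linearMap_ext_basisVec fun j => ?_
  rw [LinearMap.comp_apply]
  by_cases hj : j = i
  · rw [hj, mergeInto_basisVec_of_mem (Finset.mem_singleton_self i),
      mergeInto_basisVec_of_mem (Finset.mem_insert_self i S), mergeInto_basisVec_of_notMem hs]
  · rw [mergeInto_basisVec_of_notMem (by rwa [Finset.mem_singleton])]
    simp only [mergeInto, linearCombination_basisVec, Finset.mem_insert, hj, false_or]

theorem contractAlong_basisVec_sub (i s : Fin n) :
    contractAlong i (basisVec i - basisVec s) = mergeInto {i} s := by
  refine linearMap_ext_basisVec fun j => ?_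
  rw [contractAlong_apply]
  by_cases hj : j = i
  · rw [mergeInto_basisVec_of_mem (Finset.mem_singleton.2 hj), hj, basisVec_self, one_smul,
      sub_sub_cancel]
  · rw [mergeInto_basisVec_of_notMem (by rwa [Finset.mem_singleton]), basisVec_of_ne hj, zero_smul,
      sub_zero]

/-- The reflection `x_i ↦ -x_i`. -/
def flipSign (i : Fin n) : (Fin n → ℤ) →ₗ[ℤ] (Fin n → ℤ) :=
  Fintype.linearCombination ℤ fun j => if j = i then -basisVec j else basisVec j

theorem flipSign_basisVec_self (i : Fin n) : flipSign i (basisVec i) = -basisVec i := by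
  rw [flipSign, linearCombination_basisVec, if_pos rfl]

theorem flipSign_basisVec_of_ne (h : j ≠ i) : flipSign i (basisVec j) = basisVec j := by
  rw [flipSign, linearCombination_basisVec, if_neg h]

theorem contractAlong_basisVec_add (i s : Fin n) :
    contractAlong i (basisVec i + basisVec s) = mergeInto {i} s ∘ₗ flipSign i := by
  refine linearMap_ext_basisVec fun j => ?_
  rw [contractAlong_apply, LinearMap.comp_apply]
  by_cases hj : j = i
  · rw [hj, flipSign_basisVec_self, map_neg,
      mergeInto_basisVec_of_mem (Finset.mem_singleton_self i), basisVec_self, one_smul,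
      sub_add_cancel_left]
  · rw [flipSign_basisVec_of_ne hj, mergeInto_basisVec_of_notMem (by rwa [Finset.mem_singleton]),
      basisVec_of_ne hj, zero_smul, sub_zero]

theorem flipSign_comp_mergeInto_singleton (hji : j ≠ i) (hjs : j ≠ s) :
    flipSign j ∘ₗ mergeInto {i} s = mergeInto {i} s ∘ₗ flipSign j := by
  refine linearMap_ext_basisVec fun k => ?_
  rw [LinearMap.comp_apply, LinearMap.comp_apply]
  by_cases hki : k = i
  · rw [hki, mergeInto_basisVec_of_mem (Finset.mem_singleton_self i),
      flipSign_basisVec_of_ne hjs.symm, flipSign_basisVec_of_ne hji.symm,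
      mergeInto_basisVec_of_mem (Finset.mem_singleton_self i)]
  · rw [mergeInto_basisVec_of_notMem (by rwa [Finset.mem_singleton])]
    by_cases hkj : k = j
    · rw [hkj, flipSign_basisVec_self, map_neg,
        mergeInto_basisVec_of_notMem (by rwa [Finset.mem_singleton])]
    · rw [flipSign_basisVec_of_ne hkj, mergeInto_basisVec_of_notMem (by rwa [Finset.mem_singleton])]

/-- The class of the segment of the root `e_i - e_j`. -/
noncomputable def edge (i j : Fin n) : BodyClass n := seg (basisVec i - basisVec j)

/-- The class of the sum of the segments of the roots `e_i - e_j` and `e_i + e_j`. -/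
noncomputable def signedEdge (i j : Fin n) : BodyClass n :=
  edge i j + seg (basisVec i + basisVec j)

/-- The class of the segment of the root `e_i`. -/
noncomputable def halfEdge (i : Fin n) : BodyClass n := seg (basisVec i)

theorem edge_comm (i j : Fin n) : edge i j = edge j i := by
  rw [edge, ← seg_neg, neg_sub, edge]

theorem signedEdge_comm (i j : Fin n) : signedEdge i j = signedEdge j i := by
  rw [signedEdge, edge_comm, add_comm (basisVec i), signedEdge]

theorem edge_self (i : Fin n) : edge i i = 0 := by
  rw [edge, sub_self, seg_zero]

theorem signedEdge_self (i : Fin n) : signedEdge i i = 2 • halfEdge i := by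
  rw [signedEdge, edge_self, zero_add, ← two_smul ℤ, seg_two_smul, halfEdge]

theorem mapClass_edge {f : (Fin n → ℤ) →ₗ[ℤ] (Fin n → ℤ)} {i' j' : Fin n}
    (hi : f (basisVec i) = basisVec i') (hj : f (basisVec j) = basisVec j') :
    mapClass f (edge i j) = edge i' j' := by
  rw [edge, mapClass_seg, map_sub, hi, hj, edge]

theorem mapClass_signedEdge {f : (Fin n → ℤ) →ₗ[ℤ] (Fin n → ℤ)} {i' j' : Fin n}
    (hi : f (basisVec i) = basisVec i') (hj : f (basisVec j) = basisVec j') :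
    mapClass f (signedEdge i j) = signedEdge i' j' := by
  rw [signedEdge, map_add, mapClass_edge hi hj, mapClass_seg, map_add, hi, hj, signedEdge]

theorem mapClass_halfEdge {f : (Fin n → ℤ) →ₗ[ℤ] (Fin n → ℤ)} {i' : Fin n}
    (hi : f (basisVec i) = basisVec i') : mapClass f (halfEdge i) = halfEdge i' := by
  rw [halfEdge, mapClass_seg, hi, halfEdge]

theorem latticeCount_add_nsmul_edge (his : s ≠ i) (c : ℕ) (p : BodyClass n) :
    latticeCount (p + c • edge i s) =
      latticeCount p + c * latticeCount (mapClass (mergeInto {i} s) p) := by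
  have hone : (basisVec i - basisVec s) i = 1 := by
    rw [Pi.sub_apply, basisVec_self, basisVec_of_ne his, sub_zero]
  rw [edge, latticeCount_add_nsmul_seg p hone, contractAlong_basisVec_sub]

theorem latticeCount_add_nsmul_sum_edge (hs : s ∉ A) (c : ℕ) (p : BodyClass n) :
    latticeCount (p + c • ∑ i ∈ A, edge i s) =
      ∑ S ∈ A.powerset, c ^ S.card * latticeCount (mapClass (mergeInto S s) p) := by
  induction A using Finset.induction_on generalizing p with
  | empty => simp [mergeInto_empty, mapClass_id]
  | insert i A hi ih =>
    rw [Finset.mem_insert, not_or] at hs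
    have hfix : ∀ j ∈ A, mapClass (mergeInto {i} s) (edge j s) = edge j s := fun j hj =>
      mapClass_edge
        (mergeInto_basisVec_of_notMem (Finset.mem_singleton.not.2 (ne_of_mem_of_not_mem hj hi)))
        (mergeInto_basisVec_of_notMem (Finset.mem_singleton.not.2 hs.1))
    rw [Finset.sum_insert hi, smul_add, add_comm (c • _), ← add_assoc,
      latticeCount_add_nsmul_edge hs.1, map_add, map_nsmul, map_sum, Finset.sum_congr rfl hfix,
      ih hs.2, ih hs.2, Finset.sum_powerset_insert hi, Finset.mul_sum]
    congr 1
    refine Finset.sum_congr rfl fun S hS => ?_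
    have hSA := Finset.mem_powerset.1 hS
    rw [← mapClass_comp, mergeInto_comp_mergeInto_singleton fun h => hs.2 (hSA h),
      Finset.card_insert_of_notMem fun h => hi (hSA h), pow_succ']
    exact (mul_assoc _ _ _).symm

theorem mapClass_flipSign_signedEdge (i j k : Fin n) (hjk : j ≠ k) :
    mapClass (flipSign i) (signedEdge j k) = signedEdge j k := by
  have hleft (k : Fin n) (hk : k ≠ i) :
      mapClass (flipSign i) (signedEdge i k) = signedEdge i k := by
    rw [signedEdge, edge, map_add, mapClass_seg, mapClass_seg, map_sub, map_add,
      flipSign_basisVec_self, flipSign_basisVec_of_ne hk, ← neg_add', seg_neg, neg_add_eq_sub,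
      ← seg_neg (_ - _), neg_sub, add_comm]
  by_cases hj : j = i
  · subst hj
    exact hleft k hjk.symm
  · by_cases hk : k = i
    · subst hk
      rw [signedEdge_comm, hleft j hj]
    · exact mapClass_signedEdge (flipSign_basisVec_of_ne hj) (flipSign_basisVec_of_ne hk)

theorem mapClass_flipSign_halfEdge (i j : Fin n) :
    mapClass (flipSign i) (halfEdge j) = halfEdge j := by
  by_cases hj : j = i
  · rw [hj, halfEdge, mapClass_seg, flipSign_basisVec_self, seg_neg]
  · exact mapClass_halfEdge (flipSign_basisVec_of_ne hj)

theorem latticeCount_add_nsmul_halfEdge (b : ℕ) (p : BodyClass n) :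
    latticeCount (p + b • halfEdge s) =
      latticeCount p + b * latticeCount (mapClass (contractAlong s (basisVec s)) p) :=
  latticeCount_add_nsmul_seg p (basisVec_self s) b

/-- By the reflection symmetry of `p`, the contractions along `e_i - e_s` and `e_i + e_s` agree up
to the multiplicity of the half-edge at `s`, and the count is affine in that multiplicity. -/
theorem latticeCount_add_nsmul_signedEdge (his : s ≠ i) (c : ℕ) {p : BodyClass n}
    (hp : mapClass (flipSign i) p = p) :
    latticeCount (p + c • signedEdge i s) = latticeCount p +
      2 * c * latticeCount (mapClass (mergeInto {i} s) p + c • halfEdge s) := by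
  have hone : (basisVec i + basisVec s) i = 1 := by
    rw [Pi.add_apply, basisVec_self, basisVec_of_ne his, add_zero]
  have hedge :
      mapClass (contractAlong i (basisVec i + basisVec s)) (edge i s) = 2 • halfEdge s := by
    rw [edge, mapClass_seg, contractAlong_apply, Pi.sub_apply, basisVec_self, basisVec_of_ne his,
      sub_zero, one_smul, sub_add_eq_sub_sub, sub_sub_cancel_left, ← neg_add',
      seg_neg, ← two_smul ℤ, seg_two_smul, halfEdge]
  rw [signedEdge, smul_add, ← add_assoc, latticeCount_add_nsmul_seg _ hone, map_add, map_nsmul,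
    hedge, latticeCount_add_nsmul_edge his, contractAlong_basisVec_add, mapClass_comp, hp,
    smul_smul, latticeCount_add_nsmul_halfEdge, latticeCount_add_nsmul_halfEdge]
  ring

theorem latticeCount_add_nsmul_sum_signedEdge (hs : s ∉ A) (c : ℕ) {p : BodyClass n}
    (hp : ∀ i ∈ A, mapClass (flipSign i) p = p) :
    latticeCount (p + c • ∑ i ∈ A, signedEdge i s) =
      ∑ S ∈ A.powerset, (2 * c) ^ S.card *
        latticeCount (mapClass (mergeInto S s) p + (c * S.card) • halfEdge s) := by
  induction A using Finset.induction_on generalizing p with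
  | empty => simp [mergeInto_empty, mapClass_id]
  | insert i A hi ih =>
    rw [Finset.mem_insert, not_or] at hs
    have hs_fix (S : Finset (Fin n)) (hS : s ∉ S) :
        mapClass (mergeInto S s) (halfEdge s) = halfEdge s :=
      mapClass_halfEdge (mergeInto_basisVec_of_notMem hS)
    have hfix : ∀ j ∈ A, mapClass (mergeInto {i} s) (signedEdge j s) = signedEdge j s :=
      fun j hj => mapClass_signedEdge
        (mergeInto_basisVec_of_notMem (Finset.mem_singleton.not.2 (ne_of_mem_of_not_mem hj hi)))
        (mergeInto_basisVec_of_notMem (Finset.mem_singleton.not.2 hs.1))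
    have hflip : mapClass (flipSign i) (p + c • ∑ j ∈ A, signedEdge j s) =
        p + c • ∑ j ∈ A, signedEdge j s := by
      rw [map_add, map_nsmul, map_sum, hp i (Finset.mem_insert_self i A),
        Finset.sum_congr rfl fun j hj =>
          mapClass_flipSign_signedEdge i j s (ne_of_mem_of_not_mem hj hs.2)]
    have hflip' : ∀ j ∈ A, mapClass (flipSign j) (mapClass (mergeInto {i} s) p + c • halfEdge s) =
        mapClass (mergeInto {i} s) p + c • halfEdge s := by
      intro j hj
      rw [map_add, map_nsmul, mapClass_flipSign_halfEdge, ← mapClass_comp,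
        flipSign_comp_mergeInto_singleton (ne_of_mem_of_not_mem hj hi)
          (ne_of_mem_of_not_mem hj hs.2), mapClass_comp, hp j (Finset.mem_insert_of_mem hj)]
    rw [Finset.sum_insert hi, smul_add, add_comm (c • _), ← add_assoc,
      latticeCount_add_nsmul_signedEdge hs.1 c hflip, map_add, map_nsmul, map_sum,
      Finset.sum_congr rfl hfix, add_right_comm,
      ih hs.2 fun j hj => hp j (Finset.mem_insert_of_mem hj), ih hs.2 hflip',
      Finset.sum_powerset_insert hi, Finset.mul_sum]
    congr 1
    refine Finset.sum_congr rfl fun S hS => ?_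
    have hSA := Finset.mem_powerset.1 hS
    have hsS : s ∉ S := fun h => hs.2 (hSA h)
    rw [map_add, map_nsmul, hs_fix S hsS, ← mapClass_comp, mergeInto_comp_mergeInto_singleton hsS,
      Finset.card_insert_of_notMem fun h => hi (hSA h), pow_succ', add_assoc, ← add_smul,
      mul_add_one, add_comm c, mul_assoc (2 * c)]

end Star

/-! ## Recursions for the lattice point counts -/

section Recursion

variable {R R' : Type*} [CommSemiring R] [CommSemiring R']

/-- Over `ℕ`, the number of lattice points of the sum of `t` copies of each segment `[0, e_i - e_j]`
with `i < j ≤ m` and `c` copies of each segment `[0, e_i - e_s]` with `i ≤ m`, for one further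
index `s`. Over `ℚ[X]`, the same recursion yields the Ehrhart polynomials. -/
def starCountA (t : R) : ℕ → R → R
  | 0, _ => 1
  | m + 1, c => starCountA t m t + ∑ k ∈ Finset.range (m + 1),
      ((m + 1).choose (k + 1) : R) * (c ^ (k + 1) * starCountA t (m - k) ((k + 1 : ℕ) * t))

/-- Over `ℕ`, the number of lattice points of the sum of `t` copies of each segment
`[0, e_i ± e_j]` with `i < j ≤ m`, `h` copies of each segment `[0, e_i]` with `i ≤ m`, and `c`
copies of each segment `[0, e_i ± e_s]` with `i ≤ m`, for one further index `s`. -/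
def starCountB (t : R) : ℕ → R → R → R
  | 0, _, _ => 1
  | m + 1, c, h => starCountB t m t h + h * starCountB t m 0 (h + 2 * t) +
      ∑ k ∈ Finset.range (m + 1), ((m + 1).choose (k + 1) : R) * ((2 * c) ^ (k + 1) *
        (starCountB t (m - k) ((k + 1 : ℕ) * t) h +
          (2 * t * ((k + 1).choose 2 : ℕ) + h * (k + 1 : ℕ) + c * (k + 1 : ℕ)) *
            starCountB t (m - k) 0 (h + 2 * ((k + 1 : ℕ) * t))))

theorem starCountA_zero_right (t : R) (m : ℕ) : starCountA t (m + 1) 0 = starCountA t m t := by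
  simp [starCountA]

theorem starCountB_zero_right (t h : R) (m : ℕ) :
    starCountB t (m + 1) 0 h = starCountB t m t h + h * starCountB t m 0 (h + 2 * t) := by
  simp [starCountB]

theorem map_starCountA (f : R →+* R') (t : R) (m : ℕ) (c : R) :
    f (starCountA t m c) = starCountA (f t) m (f c) := by
  induction m using Nat.strong_induction_on generalizing c with
  | _ m ih =>
  cases m with
  | zero => simp only [starCountA, map_one]
  | succ m =>
    simp only [starCountA, map_add, map_sum, map_mul, map_pow, map_natCast,
      ih m (Nat.lt_succ_self m), ih (m - _) (Nat.lt_succ_of_le (Nat.sub_le m _))]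

theorem map_starCountB (f : R →+* R') (t : R) (m : ℕ) (c h : R) :
    f (starCountB t m c h) = starCountB (f t) m (f c) (f h) := by
  induction m using Nat.strong_induction_on generalizing c h with
  | _ m ih =>
  cases m with
  | zero => simp only [starCountB, map_one]
  | succ m =>
    simp only [starCountB, map_add, map_sum, map_mul, map_pow, map_natCast, map_ofNat, map_zero,
      ih m (Nat.lt_succ_self m), ih (m - _) (Nat.lt_succ_of_le (Nat.sub_le m _))]

theorem sum_powerset_eq_add_sum_range {ι : Type*} {A : Finset ι} {m : ℕ}
    (hA : A.card = m + 1) (g : Finset ι → R) (f : ℕ → R)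
    (h : ∀ S ⊆ A, S.Nonempty → g S = f S.card) :
    ∑ S ∈ A.powerset, g S =
      g ∅ + ∑ k ∈ Finset.range (m + 1), ((m + 1).choose (k + 1) : R) * f (k + 1) := by
  let f' : ℕ → R := fun k => if k = 0 then g ∅ else f k
  have hg : ∀ S ∈ A.powerset, g S = f' S.card := by
    intro S hS
    rcases S.eq_empty_or_nonempty with rfl | hne
    · rfl
    · rw [h S (Finset.mem_powerset.1 hS) hne]
      exact (if_neg hne.card_ne_zero).symm
  rw [Finset.sum_congr rfl hg, Finset.sum_powerset_apply_card, hA, Finset.sum_range_succ']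
  simp [f', add_comm]

end Recursion

section CountA

variable {n : ℕ} {A S : Finset (Fin n)} {s : Fin n}

theorem mapClass_mergeInto_pairSum_edge (hS : S ⊆ A) :
    mapClass (mergeInto S s) (pairSum edge A) =
      pairSum edge (A \ S) + S.card • ∑ j ∈ A \ S, edge j s := by
  have hsdiff {j : Fin n} (hj : j ∈ A \ S) := (Finset.mem_sdiff.1 hj).2
  rw [map_pairSum_collapse edge_comm hS _ 0 (fun j => edge j s), smul_zero, add_zero]
  · intro i hi j hj _
    rw [mapClass_edge (mergeInto_basisVec_of_mem hi) (mergeInto_basisVec_of_mem hj), edge_self]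
  · intro i hi j hj
    rw [mapClass_edge (mergeInto_basisVec_of_mem hi) (mergeInto_basisVec_of_notMem (hsdiff hj)),
      edge_comm]
  · intro i hi j hj
    exact mapClass_edge (mergeInto_basisVec_of_notMem (hsdiff hi))
      (mergeInto_basisVec_of_notMem (hsdiff hj))

theorem latticeCount_typeA_star (t : ℕ) {m : ℕ} (hA : A.card = m) (hs : s ∉ A) (c : ℕ) :
    latticeCount (t • pairSum edge A + c • ∑ i ∈ A, edge i s) = starCountA t m c := by
  induction m using Nat.strong_induction_on generalizing A s c with
  | _ m ih =>
  cases m with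
  | zero => simp [Finset.card_eq_zero.1 hA, pairSum_empty, latticeCount_zero, starCountA]
  | succ m =>
    have hempty : latticeCount (t • pairSum edge A) = starCountA t m t := by
      obtain ⟨s', A', hs', rfl, hA'⟩ := Finset.card_eq_succ.1 hA
      rw [pairSum_insert edge_comm hs', smul_add, ih m (Nat.lt_succ_self m) hA' hs']
    rw [latticeCount_add_nsmul_sum_edge hs, starCountA, sum_powerset_eq_add_sum_range hA _
      fun k => c ^ k * starCountA t (m + 1 - k) (k * t)]
    · simp [mergeInto_empty, mapClass_id, hempty]
    · intro S hS hne
      have hcard : (A \ S).card = m + 1 - S.card := by rw [Finset.card_sdiff_of_subset hS, hA]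
      have hlt : m + 1 - S.card < m + 1 := Nat.sub_lt (Nat.succ_pos m) hne.card_pos
      rw [map_nsmul, mapClass_mergeInto_pairSum_edge hS, smul_add, smul_smul, mul_comm t,
        ih _ hlt hcard fun h => hs (Finset.mem_sdiff.1 h).1]

theorem latticeCount_typeA (t : ℕ) (A : Finset (Fin n)) :
    latticeCount (t • pairSum edge A) = starCountA t A.card 0 := by
  induction A using Finset.induction_on with
  | empty => simp [pairSum_empty, latticeCount_zero, starCountA]
  | insert s A hs _ =>
    rw [pairSum_insert edge_comm hs, smul_add, latticeCount_typeA_star t rfl hs,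
      Finset.card_insert_of_notMem hs, starCountA_zero_right]

end CountA

section CountB

variable {n : ℕ} {A S : Finset (Fin n)} {s : Fin n}

/-- The class of the Minkowski sum of `t` copies of the segments `[0, e_i ± e_j]` and `h` copies of
the segments `[0, e_i]` with `i` and `j` in `A`. -/
noncomputable def typeBClass (t h : ℕ) (A : Finset (Fin n)) : BodyClass n :=
  t • pairSum signedEdge A + h • ∑ i ∈ A, halfEdge i

theorem typeBClass_empty (t h : ℕ) : typeBClass t h (∅ : Finset (Fin n)) = 0 := by
  simp [typeBClass, pairSum_empty]

theorem typeBClass_insert (t h : ℕ) (hs : s ∉ A) :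
    typeBClass t h (insert s A) =
      typeBClass t h A + t • ∑ i ∈ A, signedEdge i s + h • halfEdge s := by
  rw [typeBClass, typeBClass, pairSum_insert signedEdge_comm hs, Finset.sum_insert hs, smul_add,
    smul_add]
  abel

theorem mapClass_flipSign_typeBClass (t h : ℕ) (A : Finset (Fin n)) (i : Fin n) :
    mapClass (flipSign i) (typeBClass t h A) = typeBClass t h A := by
  simp only [typeBClass, map_add, map_nsmul, map_sum, map_pairSum, mapClass_flipSign_halfEdge]
  rw [pairSum_congr fun j _ k _ hjk => mapClass_flipSign_signedEdge i j k hjk.ne']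

theorem mapClass_mergeInto_typeBClass (t h : ℕ) (hS : S ⊆ A) :
    mapClass (mergeInto S s) (typeBClass t h A) =
      typeBClass t h (A \ S) + (S.card * t) • ∑ i ∈ A \ S, signedEdge i s +
        (2 * t * S.card.choose 2 + h * S.card) • halfEdge s := by
  have hmem {j : Fin n} (hj : j ∈ S) : mergeInto S s (basisVec j) = basisVec s :=
    mergeInto_basisVec_of_mem hj
  have hsdiff {j : Fin n} (hj : j ∈ A \ S) : mergeInto S s (basisVec j) = basisVec j :=
    mergeInto_basisVec_of_notMem (Finset.mem_sdiff.1 hj).2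
  rw [typeBClass, map_add, map_nsmul, map_nsmul,
    map_pairSum_collapse signedEdge_comm hS _ (2 • halfEdge s) (fun j => signedEdge j s)
      (fun i hi j hj _ => by rw [mapClass_signedEdge (hmem hi) (hmem hj), signedEdge_self])
      (fun i hi j hj => by rw [mapClass_signedEdge (hmem hi) (hsdiff hj), signedEdge_comm])
      (fun i hi j hj => mapClass_signedEdge (hsdiff hi) (hsdiff hj)),
    map_sum_collapse hS _ (halfEdge s) (fun i hi => mapClass_halfEdge (hmem hi))
      (fun i hi => mapClass_halfEdge (hsdiff hi)), typeBClass]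
  module

theorem mapClass_contractAlong_typeB_star (t h c : ℕ) (hs : s ∉ A) :
    mapClass (contractAlong s (basisVec s)) (typeBClass t h A + c • ∑ i ∈ A, signedEdge i s) =
      typeBClass t (h + 2 * c) A := by
  have hfix {j : Fin n} (hj : j ∈ A) :
      contractAlong s (basisVec s) (basisVec j) = basisVec j := by
    rw [contractAlong_apply, basisVec_of_ne (ne_of_mem_of_not_mem hj hs), zero_smul, sub_zero]
  have hzero : contractAlong s (basisVec s) (basisVec s) = 0 := by
    rw [contractAlong_apply, basisVec_self, one_smul, sub_self]
  have hstar : ∀ i ∈ A,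
      mapClass (contractAlong s (basisVec s)) (signedEdge i s) = 2 • halfEdge i := by
    intro i hi
    rw [signedEdge, edge, map_add, mapClass_seg, mapClass_seg, map_sub, map_add, hfix hi, hzero,
      sub_zero, add_zero, two_nsmul, halfEdge]
  rw [typeBClass, map_add, map_add, map_nsmul, map_nsmul, map_nsmul, map_pairSum, map_sum, map_sum,
    pairSum_congr (fun i hi j hj _ => mapClass_signedEdge (hfix hi) (hfix hj)),
    Finset.sum_congr rfl (fun i hi => mapClass_halfEdge (hfix hi)), Finset.sum_congr rfl hstar,
    ← Finset.smul_sum, typeBClass]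
  module

theorem latticeCount_typeB_star_add_halfEdge (t h c b : ℕ) (hs : s ∉ A) :
    latticeCount (typeBClass t h A + c • ∑ i ∈ A, signedEdge i s + b • halfEdge s) =
      latticeCount (typeBClass t h A + c • ∑ i ∈ A, signedEdge i s) +
        b * latticeCount (typeBClass t (h + 2 * c) A) := by
  rw [latticeCount_add_nsmul_halfEdge, mapClass_contractAlong_typeB_star t h c hs]

theorem latticeCount_typeB_star (t : ℕ) {m : ℕ} (hA : A.card = m) (hs : s ∉ A) (c h : ℕ) :
    latticeCount (typeBClass t h A + c • ∑ i ∈ A, signedEdge i s) = starCountB t m c h := by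
  induction m using Nat.strong_induction_on generalizing A s c h with
  | _ m ih =>
  have ih_half {k : ℕ} (hk : k < m) {B : Finset (Fin n)} (hB : B.card = k) {s' : Fin n}
      (hs' : s' ∉ B) (c' b : ℕ) :
      latticeCount (typeBClass t h B + c' • ∑ i ∈ B, signedEdge i s' + b • halfEdge s') =
        starCountB t k c' h + b * starCountB t k 0 (h + 2 * c') := by
    rw [latticeCount_typeB_star_add_halfEdge t h c' b hs', ih k hk hB hs', ← ih k hk hB hs' 0,
      zero_smul, add_zero]
  cases m with
  | zero => simp [Finset.card_eq_zero.1 hA, typeBClass_empty, latticeCount_zero, starCountB]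
  | succ m =>
    have hempty : latticeCount (typeBClass t h A) =
        starCountB t m t h + h * starCountB t m 0 (h + 2 * t) := by
      obtain ⟨s', A', hs', rfl, hA'⟩ := Finset.card_eq_succ.1 hA
      rw [typeBClass_insert t h hs', ih_half (Nat.lt_succ_self m) hA' hs']
    rw [latticeCount_add_nsmul_sum_signedEdge hs c fun i _ => mapClass_flipSign_typeBClass t h A i,
      starCountB, sum_powerset_eq_add_sum_range hA _ fun k => (2 * c) ^ k *
        (starCountB t (m + 1 - k) (k * t) h + (2 * t * k.choose 2 + h * k + c * k) *
          starCountB t (m + 1 - k) 0 (h + 2 * (k * t)))]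
    · simp [mergeInto_empty, mapClass_id, hempty]
    · intro S hS hne
      have hcard : (A \ S).card = m + 1 - S.card := by rw [Finset.card_sdiff_of_subset hS, hA]
      have hlt : m + 1 - S.card < m + 1 := Nat.sub_lt (Nat.succ_pos m) hne.card_pos
      rw [mapClass_mergeInto_typeBClass t h hS, add_assoc, ← add_smul,
        ih_half hlt hcard fun h => hs (Finset.mem_sdiff.1 h).1]

theorem latticeCount_typeBClass (t h : ℕ) (A : Finset (Fin n)) :
    latticeCount (typeBClass t h A) = starCountB t A.card 0 h := by
  induction A using Finset.induction_on with
  | empty => simp [typeBClass_empty, latticeCount_zero, starCountB]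
  | insert s A hs _ =>
    rw [typeBClass_insert t h hs, latticeCount_typeB_star_add_halfEdge t h t h hs,
      latticeCount_typeB_star t rfl hs, Finset.card_insert_of_notMem hs, starCountB_zero_right,
      ← latticeCount_typeB_star t rfl hs 0, zero_smul, add_zero]

end CountB

/-! ## Coxeter permutahedra -/

section Coxeter

variable {n : ℕ}

theorem coe_sum_segBody (Φ : Finset (Fin n → ℤ)) :
    ((∑ α ∈ Φ, segBody α : ConvexBody (Fin n → ℝ)) : Set (Fin n → ℝ)) =
      integralCoxeterPermutahedron Φ := by
  rw [integralCoxeterPermutahedron]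
  induction Φ using Finset.induction_on with
  | empty => rw [Finset.sum_empty, Finset.sum_empty, ConvexBody.coe_zero]
  | insert α Φ hα ih =>
    rw [Finset.sum_insert hα, Finset.sum_insert hα, ConvexBody.coe_add, ih, coe_segBody]

theorem coe_nsmul_convexBody (t : ℕ) (P : ConvexBody (Fin n → ℝ)) :
    ((t • P : ConvexBody (Fin n → ℝ)) : Set (Fin n → ℝ)) = (t : ℝ) • (P : Set (Fin n → ℝ)) := by
  rw [← Nat.cast_smul_eq_nsmul NNReal t P, ConvexBody.coe_smul', NNReal.smul_def,
    NNReal.coe_natCast]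

theorem dilateLatticePoints_integralCoxeterPermutahedron (Φ : Finset (Fin n → ℤ)) (t : ℕ) :
    dilateLatticePoints (integralCoxeterPermutahedron Φ) t =
      latticePoints (t • ∑ α ∈ Φ, segBody α) := by
  ext z
  rw [Finset.mem_coe, mem_latticePoints, ← SetLike.mem_coe, coe_nsmul_convexBody, coe_sum_segBody]
  rfl

theorem isEhrhartPolynomial_of_latticeCount {Φ : Finset (Fin n → ℤ)} {p : Polynomial ℚ}
    (h : ∀ t : ℕ, (latticeCount (t • ∑ α ∈ Φ, seg α) : ℚ) = p.eval (t : ℚ)) :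
    IsEhrhartPolynomial (integralCoxeterPermutahedron Φ) p := by
  intro t _
  have hclass : t • ∑ α ∈ Φ, seg α = bodyClass (t • ∑ α ∈ Φ, segBody α) := by
    simp only [seg, map_nsmul, map_sum]
  rw [dilateLatticePoints_integralCoxeterPermutahedron, Set.ncard_coe_finset,
    ← latticeCount_bodyClass, ← hclass]
  exact ⟨Finset.finite_toSet _, h t⟩

theorem sum_filter_lt_eq_pairSum {ι M : Type*} [LinearOrder ι] [Fintype ι] [AddCommMonoid M]
    {f : ι → ι → M} (hf : ∀ i j, f i j = f j i) :
    ∑ p : ι × ι with p.1 < p.2, f p.1 p.2 = pairSum f Finset.univ := by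
  simp only [pairSum, Finset.sum_filter]
  rw [Fintype.sum_prod_type, Finset.sum_comm]
  simp only [hf]

theorem injOn_single_sub_single (n : ℕ) :
    Set.InjOn (fun p : Fin n × Fin n => (Pi.single p.1 1 - Pi.single p.2 1 : Fin n → ℤ))
      {p | p.1 < p.2} := by
  rintro ⟨i, j⟩ hij ⟨k, l⟩ hkl h
  have hi := congrFun h i
  have hj := congrFun h j
  simp only [Set.mem_ofPred_eq, Pi.sub_apply, Pi.single_apply] at hij hkl hi hj
  grind

theorem injOn_single_add_single (n : ℕ) :
    Set.InjOn (fun p : Fin n × Fin n => (Pi.single p.1 1 + Pi.single p.2 1 : Fin n → ℤ))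
      {p | p.1 < p.2} := by
  rintro ⟨i, j⟩ hij ⟨k, l⟩ hkl h
  have hi := congrFun h i
  have hj := congrFun h j
  simp only [Set.mem_ofPred_eq, Pi.add_apply, Pi.single_apply] at hij hkl hi hj
  grind

theorem mem_positiveRootsA {x : Fin n → ℤ} :
    x ∈ positiveRootsA n ↔ ∃ i j, i < j ∧ Pi.single i 1 - Pi.single j 1 = x := by
  simp [positiveRootsA]

theorem mem_positiveRootsD {x : Fin n → ℤ} :
    x ∈ positiveRootsD n ↔ ∃ i j, i < j ∧
      (Pi.single i 1 - Pi.single j 1 = x ∨ Pi.single i 1 + Pi.single j 1 = x) := by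
  simp only [positiveRootsD, Finset.mem_union, mem_positiveRootsA, Finset.mem_image,
    Finset.mem_filter, Finset.mem_univ, true_and, Prod.exists, and_or_left, exists_or]

theorem sum_positiveRootsA (n : ℕ) :
    ∑ α ∈ positiveRootsA n, seg α = pairSum edge Finset.univ := by
  rw [positiveRootsA, Finset.sum_image (by simpa using injOn_single_sub_single n),
    ← sum_filter_lt_eq_pairSum edge_comm]
  rfl

theorem sum_positiveRootsD (n : ℕ) :
    ∑ α ∈ positiveRootsD n, seg α = pairSum signedEdge Finset.univ := by
  have hdisj : Disjoint (positiveRootsA n)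
      (((Finset.univ : Finset (Fin n × Fin n)).filter fun p => p.1 < p.2).image
        fun p => Pi.single p.1 1 + Pi.single p.2 1) := by
    refine Finset.disjoint_left.2 fun x hx hx' => ?_
    obtain ⟨i, j, hij, rfl⟩ := mem_positiveRootsA.1 hx
    obtain ⟨⟨k, l⟩, -, h⟩ := Finset.mem_image.1 hx'
    have hj := congrFun h j
    simp only [Pi.add_apply, Pi.sub_apply, Pi.single_apply] at hj
    grind
  rw [positiveRootsD, Finset.sum_union hdisj, sum_positiveRootsA,
    Finset.sum_image (by simpa using injOn_single_add_single n),
    ← sum_filter_lt_eq_pairSum edge_comm, ← sum_filter_lt_eq_pairSum signedEdge_comm,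
    ← Finset.sum_add_distrib]
  rfl

theorem single_one_notMem_positiveRootsD (i : Fin n) : Pi.single i 1 ∉ positiveRootsD n := by
  rw [mem_positiveRootsD]
  rintro ⟨j, k, -, h | h⟩ <;>
  · have hsum := congrArg (fun x => ∑ m, x m) h
    simp [Finset.sum_add_distrib] at hsum

theorem single_two_notMem_positiveRootsD (i : Fin n) : Pi.single i 2 ∉ positiveRootsD n := by
  rw [mem_positiveRootsD]
  rintro ⟨j, k, hjk, h | h⟩ <;>
  · have hi := congrFun h i
    simp only [Pi.add_apply, Pi.sub_apply, Pi.single_apply] at hi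
    grind

theorem sum_positiveRootsD_union_single {a : ℤ} (ha : a ≠ 0)
    (hD : ∀ i : Fin n, Pi.single i a ∉ positiveRootsD n) :
    ∑ α ∈ positiveRootsD n ∪ Finset.univ.image (fun i => Pi.single i a), seg α =
      pairSum signedEdge Finset.univ + ∑ i : Fin n, seg (a • basisVec i) := by
  have hdisj : Disjoint (positiveRootsD n) (Finset.univ.image fun i => Pi.single i a) :=
    Finset.disjoint_right.2 fun x hx => by
      obtain ⟨i, -, rfl⟩ := Finset.mem_image.1 hx
      exact hD i
  have hinj : Function.Injective fun i : Fin n => (Pi.single i a : Fin n → ℤ) := fun i j h => by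
    have hi := congrFun h i
    simp only [Pi.single_apply] at hi
    grind
  rw [Finset.sum_union hdisj, sum_positiveRootsD, Finset.sum_image hinj.injOn]
  simp only [basisVec, ← Pi.single_smul, smul_eq_mul, mul_one]

theorem sum_positiveRootsB (n : ℕ) :
    ∑ α ∈ positiveRootsB n, seg α = pairSum signedEdge Finset.univ + ∑ i : Fin n, halfEdge i := by
  rw [positiveRootsB, sum_positiveRootsD_union_single one_ne_zero single_one_notMem_positiveRootsD]
  simp only [one_smul, halfEdge]

theorem sum_positiveRootsC (n : ℕ) :
    ∑ α ∈ positiveRootsC n, seg α =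
      pairSum signedEdge Finset.univ + 2 • ∑ i : Fin n, halfEdge i := by
  rw [positiveRootsC, sum_positiveRootsD_union_single two_ne_zero single_two_notMem_positiveRootsD,
    Finset.smul_sum]
  simp only [seg_two_smul, halfEdge]

/-- The Ehrhart polynomial of the permutahedron of type `A_{n-1}`. -/
noncomputable def ehrhartA (n : ℕ) : Polynomial ℚ := starCountA Polynomial.X n 0

/-- The Ehrhart polynomial of the sum of the segments `[0, e_i ± e_j]` and `a` copies of each
segment `[0, e_i]`, for `i` and `j` in a set of `n` indices. The types `D`, `B` and `C` are the
cases `a = 0, 1, 2`. -/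
noncomputable def ehrhartB (a n : ℕ) : Polynomial ℚ :=
  starCountB Polynomial.X n 0 ((a : Polynomial ℚ) * Polynomial.X)

theorem eval_ehrhartA (n : ℕ) (t : ℚ) : (ehrhartA n).eval t = starCountA t n 0 := by
  rw [ehrhartA, ← Polynomial.coe_evalRingHom, map_starCountA, Polynomial.coe_evalRingHom,
    Polynomial.eval_X, Polynomial.eval_zero]

theorem eval_ehrhartB (a n : ℕ) (t : ℚ) : (ehrhartB a n).eval t = starCountB t n 0 (a * t) := by
  rw [ehrhartB, ← Polynomial.coe_evalRingHom, map_starCountB, map_zero, map_mul, map_natCast,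
    Polynomial.coe_evalRingHom, Polynomial.eval_X]

theorem isEhrhartPolynomial_ehrhartA (n : ℕ) :
    IsEhrhartPolynomial (integralCoxeterPermutahedron (positiveRootsA n)) (ehrhartA n) :=
  isEhrhartPolynomial_of_latticeCount fun t => by
    rw [sum_positiveRootsA, latticeCount_typeA, eval_ehrhartA, Finset.card_fin,
      ← Nat.coe_castRingHom, map_starCountA, map_zero]

theorem isEhrhartPolynomial_ehrhartB {Φ : Finset (Fin n → ℤ)} (a : ℕ)
    (hΦ : ∑ α ∈ Φ, seg α = pairSum signedEdge Finset.univ + a • ∑ i : Fin n, halfEdge i) :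
    IsEhrhartPolynomial (integralCoxeterPermutahedron Φ) (ehrhartB a n) :=
  isEhrhartPolynomial_of_latticeCount fun t => by
    have hclass : t • ∑ α ∈ Φ, seg α = typeBClass t (a * t) Finset.univ := by
      rw [hΦ, typeBClass, smul_add, smul_smul, mul_comm]
    rw [hclass, latticeCount_typeBClass, eval_ehrhartB, Finset.card_fin, ← Nat.coe_castRingHom,
      map_starCountB, map_zero, map_mul]

end Coxeter

/-! ## Exponentials and square roots of power series -/

section ExpSeries

open PowerSeries

theorem constantCoeff_subst_of_constantCoeff_eq_zero (f : PowerSeries ℚ) {y : PowerSeries ℚ}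
    (hy : constantCoeff y = 0) : constantCoeff (f.subst y) = constantCoeff f := by
  have hs : HasSubst y := HasSubst.of_constantCoeff_zero' hy
  have h := constantCoeff_subst_eq_zero (f := f - C (constantCoeff f)) hy (by simp)
  rw [subst_sub hs, subst_C] at h
  change constantCoeff (f.subst y - C (constantCoeff f)) = 0 at h
  rwa [map_sub, constantCoeff_C, sub_eq_zero] at h

theorem constantCoeff_expSeries {f : PowerSeries ℚ} (hf : constantCoeff f = 0) :
    constantCoeff (expSeries f) = 1 := by
  rw [expSeries, constantCoeff_subst_of_constantCoeff_eq_zero _ hf, constantCoeff_exp]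

theorem derivative_expSeries {f : PowerSeries ℚ} (hf : constantCoeff f = 0) :
    d⁄dX ℚ (expSeries f) = expSeries f * d⁄dX ℚ f := by
  rw [expSeries, derivative_subst (HasSubst.of_constantCoeff_zero' hf), derivative_exp]

theorem expSeries_mul_expSeries_neg {f : PowerSeries ℚ} (hf : constantCoeff f = 0) :
    expSeries f * expSeries (-f) = 1 := by
  have hf' : constantCoeff (-f) = 0 := by rw [map_neg, hf, neg_zero]
  refine derivative.ext ?_ ?_
  · rw [Derivation.leibniz, derivative_expSeries hf, derivative_expSeries hf', map_neg,
      derivative_one, smul_eq_mul, smul_eq_mul]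
    ring
  · rw [map_mul, constantCoeff_expSeries hf, constantCoeff_expSeries hf', mul_one, map_one]

theorem eq_expSeries_of_derivative {f y : PowerSeries ℚ} (hf : constantCoeff f = 0)
    (hy : constantCoeff y = 1) (h : d⁄dX ℚ y = y * d⁄dX ℚ f) : y = expSeries f := by
  have hf' : constantCoeff (-f) = 0 := by rw [map_neg, hf, neg_zero]
  have hquot : y * expSeries (-f) = 1 := by
    refine derivative.ext ?_ ?_
    · rw [Derivation.leibniz, h, derivative_expSeries hf', map_neg, derivative_one, smul_eq_mul,
        smul_eq_mul]
      ring
    · rw [map_mul, hy, constantCoeff_expSeries hf', mul_one, map_one]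
  linear_combination (-y) * expSeries_mul_expSeries_neg hf + expSeries f * hquot

theorem expSeries_zero : expSeries 0 = 1 :=
  (eq_expSeries_of_derivative (map_zero _) (map_one _) (by simp)).symm

theorem expSeries_add {f g : PowerSeries ℚ} (hf : constantCoeff f = 0)
    (hg : constantCoeff g = 0) : expSeries (f + g) = expSeries f * expSeries g := by
  symm
  refine eq_expSeries_of_derivative (by rw [map_add, hf, hg, add_zero]) ?_ ?_
  · rw [map_mul, constantCoeff_expSeries hf, constantCoeff_expSeries hg, mul_one]
  · rw [Derivation.leibniz, derivative_expSeries hf, derivative_expSeries hg, map_add,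
      smul_eq_mul, smul_eq_mul]
    ring

theorem expSeries_natCast_mul {f : PowerSeries ℚ} (hf : constantCoeff f = 0) (k : ℕ) :
    expSeries (k * f) = expSeries f ^ k := by
  induction k with
  | zero => rw [Nat.cast_zero, zero_mul, expSeries_zero, pow_zero]
  | succ k ih =>
    rw [Nat.cast_succ, add_one_mul, expSeries_add (by simp [hf]) hf, ih, pow_succ]

theorem rescale_expSeries (c : ℚ) {f : PowerSeries ℚ} (hf : constantCoeff f = 0) :
    rescale c (expSeries f) = expSeries (rescale c f) := by
  rw [expSeries, expSeries, rescale_eq_subst, rescale_eq_subst,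
    subst_comp_subst_apply (HasSubst.of_constantCoeff_zero' hf) (HasSubst.smul_X' c)]

theorem constantCoeff_sqrtOneAdd {f : PowerSeries ℚ} (hf : constantCoeff f = 0) :
    constantCoeff (sqrtOneAdd f) = 1 := by
  rw [sqrtOneAdd, constantCoeff_subst_of_constantCoeff_eq_zero _ hf,
    ← coeff_zero_eq_constantCoeff_apply, binomialSeries_coeff, Ring.choose_zero_right, one_smul]

theorem derivative_inv_sqrtOneAdd {f v : PowerSeries ℚ} (hf : constantCoeff f = 0)
    (hv : v * (1 + f) = 1) :
    d⁄dX ℚ (sqrtOneAdd f)⁻¹ = -(C (1 / 2 : ℚ) * v * d⁄dX ℚ f * (sqrtOneAdd f)⁻¹) := by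
  set r := sqrtOneAdd f with hr
  have hsq : r ^ 2 = 1 + f := sqrtOneAdd_sq f hf
  have hinv : r * r⁻¹ = 1 :=
    PowerSeries.mul_inv_cancel r (by rw [hr, constantCoeff_sqrtOneAdd hf]; exact one_ne_zero)
  have hd : 2 * r * d⁄dX ℚ r = d⁄dX ℚ f := by
    have h := congrArg (d⁄dX ℚ) hsq
    rw [derivative_pow, map_add, derivative_one] at h
    push_cast at h
    linear_combination h
  have hv' : r⁻¹ ^ 2 = v := by
    linear_combination (-r⁻¹ ^ 2) * hv + v * r⁻¹ ^ 2 * hsq.symm + v * (r * r⁻¹ + 1) * hinv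
  have hhalf : C (1 / 2 : ℚ) * 2 = (1 : PowerSeries ℚ) := by
    rw [← map_ofNat (C : ℚ →+* PowerSeries ℚ) 2, ← map_mul, one_div_mul_cancel two_ne_zero, map_one]
  rw [derivative_inv', hv']
  linear_combination v * d⁄dX ℚ r * hhalf + 2 * C (1 / 2 : ℚ) * v * d⁄dX ℚ r * hinv -
    C (1 / 2 : ℚ) * v * r⁻¹ * hd

end ExpSeries

/-! ## Coefficients of exponential generating functions -/

section EgfCoeff

open PowerSeries

/-- The coefficient of `x ^ m / m!` in a power series. -/
noncomputable def egfCoeff (m : ℕ) : PowerSeries ℚ →ₗ[ℚ] ℚ := (m ! : ℚ) • coeff m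

theorem egfCoeff_apply (m : ℕ) (F : PowerSeries ℚ) : egfCoeff m F = (m ! : ℚ) * coeff m F := rfl

theorem egfCoeff_C_mul (m : ℕ) (c : ℚ) (F : PowerSeries ℚ) :
    egfCoeff m (C c * F) = c * egfCoeff m F := by
  rw [← smul_eq_C_mul, map_smul, smul_eq_mul]

theorem egfCoeff_zero (F : PowerSeries ℚ) : egfCoeff 0 F = constantCoeff F := by
  rw [egfCoeff_apply, Nat.factorial_zero, Nat.cast_one, one_mul, coeff_zero_eq_constantCoeff_apply]

theorem egfCoeff_succ (m : ℕ) (F : PowerSeries ℚ) :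
    egfCoeff (m + 1) F = egfCoeff m (d⁄dX ℚ F) := by
  rw [egfCoeff_apply, egfCoeff_apply, coeff_derivative, Nat.factorial_succ]
  push_cast
  ring

theorem egfCoeff_exp (k : ℕ) : egfCoeff k (exp ℚ) = 1 := by
  rw [egfCoeff_apply, coeff_exp]
  simp [Nat.factorial_ne_zero]

theorem egfCoeff_X_mul (k : ℕ) (F : PowerSeries ℚ) :
    egfCoeff k (X * F) = k * egfCoeff (k - 1) F := by
  cases k with
  | zero => simp [egfCoeff_apply]
  | succ k =>
    rw [egfCoeff_apply, coeff_succ_X_mul, egfCoeff_apply, Nat.factorial_succ, Nat.add_sub_cancel]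
    push_cast
    ring

theorem egfAt_eq_of_eval {p : ℕ → Polynomial ℚ} {t : ℚ} {F : PowerSeries ℚ}
    (h : ∀ n, (p n).eval t = egfCoeff n F) : egfAt p t = F := by
  ext n
  rw [egfAt, coeff_mk, h, egfCoeff_apply,
    mul_div_cancel_left₀ _ (Nat.cast_ne_zero.2 (Nat.factorial_ne_zero n))]

theorem X_pow_dvd_subst_sub_sum (f u : PowerSeries ℚ) (c : ℚ) (m : ℕ) :
    X ^ (m + 1) ∣ f.subst (C c * X * u) -
      ∑ k ∈ Finset.range (m + 1), C (coeff k f) * (C c * X * u) ^ k := by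
  have hy : HasSubst (C c * X * u) := HasSubst.of_constantCoeff_zero' (by simp)
  have hpow {k j : ℕ} (hjk : j < k) : coeff j ((C c * X * u) ^ k) = 0 := by
    rw [mul_right_comm, mul_pow, coeff_mul_X_pow', if_neg hjk.not_ge]
  rw [X_pow_dvd_iff]
  intro j hj
  rw [map_sub, sub_eq_zero, coeff_subst' hy, map_sum, finsum_eq_sum_of_support_subset]
  · exact Finset.sum_congr rfl fun k _ => by rw [coeff_C_mul, smul_eq_mul]
  · intro k hk
    rw [Finset.coe_range, Set.mem_Iio]
    by_contra hlt
    exact hk (by simp only [hpow (show j < k by omega), smul_zero])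

theorem egfCoeff_subst_mul (f u G : PowerSeries ℚ) (c : ℚ) (m : ℕ) :
    egfCoeff m (f.subst (C c * X * u) * G) =
      ∑ k ∈ Finset.range (m + 1), (m.choose k : ℚ) *
        (c ^ k * (egfCoeff k f * egfCoeff (m - k) (u ^ k * G))) := by
  have h := X_pow_dvd_iff.1 ((X_pow_dvd_subst_sub_sum f u c m).mul_right G) m (Nat.lt_succ_self m)
  rw [sub_mul, map_sub, sub_eq_zero] at h
  rw [egfCoeff_apply, h, Finset.sum_mul, map_sum, Finset.mul_sum]
  refine Finset.sum_congr rfl fun k hk => ?_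
  have hkm : k ≤ m := Nat.lt_succ_iff.1 (Finset.mem_range.1 hk)
  have hterm : C (coeff k f) * (C c * X * u) ^ k * G =
      C (coeff k f * c ^ k) * (X ^ k * (u ^ k * G)) := by
    rw [map_mul, map_pow]; ring
  rw [hterm, coeff_C_mul, coeff_X_pow_mul', if_pos hkm, egfCoeff_apply, egfCoeff_apply,
    ← Nat.choose_mul_factorial_mul_factorial hkm]
  push_cast
  ring

/-- This is `∑ₖ (1 + k B + k (k - 1) D) y ^ k / k! = exp(y) (1 + y B + y ^ 2 D)` with
`y = c x u`. -/
theorem egfCoeff_expSeries_mul (u B D G : PowerSeries ℚ) (c : ℚ) (m : ℕ) :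
    egfCoeff m (expSeries (C c * X * u) * (1 + C c * X * u * B + (C c * X * u) ^ 2 * D) * G) =
      ∑ k ∈ Finset.range (m + 1), (m.choose k : ℚ) * (c ^ k *
        egfCoeff (m - k) (u ^ k * ((1 + C (k : ℚ) * B + C ((k : ℚ) * (k - 1)) * D) * G))) := by
  set y := C c * X * u with hy
  have hs : HasSubst y := HasSubst.of_constantCoeff_zero' (by simp [hy])
  have hX : (X * exp ℚ).subst y = y * expSeries y := by
    rw [subst_mul hs, subst_X hs, expSeries]
  have hXX : (X * (X * exp ℚ)).subst y = y ^ 2 * expSeries y := by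
    rw [subst_mul hs, hX, subst_X hs]; ring
  have hsplit : expSeries y * (1 + y * B + y ^ 2 * D) * G =
      (exp ℚ).subst y * G + (X * exp ℚ).subst y * (B * G) +
        (X * (X * exp ℚ)).subst y * (D * G) := by
    rw [hX, hXX, expSeries]; ring
  rw [hsplit, map_add, map_add, egfCoeff_subst_mul, egfCoeff_subst_mul, egfCoeff_subst_mul,
    ← Finset.sum_add_distrib, ← Finset.sum_add_distrib]
  refine Finset.sum_congr rfl fun k _ => ?_
  have hterm : u ^ k * ((1 + C (k : ℚ) * B + C ((k : ℚ) * (k - 1)) * D) * G) =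
      u ^ k * G + C (k : ℚ) * (u ^ k * (B * G)) + C ((k : ℚ) * (k - 1)) * (u ^ k * (D * G)) := by
    ring
  rw [hterm, map_add, map_add, egfCoeff_C_mul, egfCoeff_C_mul]
  simp only [egfCoeff_X_mul, egfCoeff_exp]
  cases k with
  | zero => simp
  | succ k =>
    push_cast
    ring

end EgfCoeff

/-! ## The tree function -/

section TreeSeries

open PowerSeries

theorem exists_eq_X_mul_expSeries :
    ∃ T : PowerSeries ℚ, constantCoeff T = 0 ∧ T = X * expSeries T := by
  have hX : constantCoeff (-X : PowerSeries ℚ) = 0 := by simp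
  set P : PowerSeries ℚ := X * expSeries (-X) with hP
  have hP1 : coeff 1 P = 1 := by
    rw [hP, coeff_succ_X_mul, coeff_zero_eq_constantCoeff_apply, constantCoeff_expSeries hX]
  let _ : Invertible (coeff 1 P) := by rw [hP1]; exact invertibleOne
  have hP0 : constantCoeff P = 0 := by simp [hP]
  have hT0 : constantCoeff P.substInv = 0 := constantCoeff_substInv P
  have hinv : P.subst P.substInv = X := subst_substInv_right P hP0
  set T := P.substInv
  have hs : HasSubst T := HasSubst.of_constantCoeff_zero' hT0
  have hsubst : P.subst T = T * expSeries (-T) := by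
    rw [hP, subst_mul hs, subst_X hs, expSeries, expSeries,
      subst_comp_subst_apply (HasSubst.of_constantCoeff_zero' hX) hs, ← coe_substAlgHom hs,
      map_neg, coe_substAlgHom hs, subst_X hs]
  refine ⟨T, hT0, ?_⟩
  linear_combination expSeries T * (hsubst.symm.trans hinv) - T * expSeries_mul_expSeries_neg hT0

/-- The number `a (a + m) ^ (m - 1)` of forests on `a + m` vertices in which `a` specified
vertices are the roots of the components. The case `m = 0` is separate since the exponent would
be truncated. -/
def rootedForestCount (a m : ℕ) : ℕ := if m = 0 then 1 else a * (a + m) ^ (m - 1)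

theorem choose_mul_rootedForestCount {p j : ℕ} (hj : j ≤ p) :
    (p + 1).choose (j + 1) * rootedForestCount (j + 1) (p - j) =
      p.choose j * (p + 1) ^ (p - j) := by
  obtain ⟨q, rfl⟩ := Nat.exists_eq_add_of_le hj
  rw [Nat.add_sub_cancel_left, rootedForestCount]
  rcases q with _ | q
  · simp
  · rw [if_neg (Nat.succ_ne_zero q), Nat.add_sub_cancel, pow_succ',
      show j + 1 + (q + 1) = j + (q + 1) + 1 by ring, ← mul_assoc,
      ← Nat.add_one_mul_choose_eq (j + (q + 1)) j]
    ring

theorem rootedForestCount_eq_sum (a m : ℕ) : rootedForestCount a m =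
    ∑ k ∈ Finset.range (m + 1), m.choose k * (a ^ k * rootedForestCount k (m - k)) := by
  rcases m with _ | p
  · simp [rootedForestCount]
  · rw [Finset.sum_range_succ']
    have hroot : rootedForestCount 0 (p + 1 - 0) = 0 := by simp [rootedForestCount]
    rw [hroot, mul_zero, mul_zero, add_zero, rootedForestCount, if_neg (Nat.succ_ne_zero p),
      Nat.add_sub_cancel, add_pow, Finset.mul_sum]
    refine Finset.sum_congr rfl fun j hj => ?_
    rw [Nat.add_sub_add_right, mul_left_comm ((p + 1).choose _), choose_mul_rootedForestCount
      (Nat.lt_succ_iff.1 (Finset.mem_range.1 hj)), pow_succ, Nat.cast_id]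
    ring

theorem egfCoeff_one (m : ℕ) : egfCoeff m 1 = rootedForestCount 0 m := by
  rw [egfCoeff_apply, coeff_one, rootedForestCount]
  split_ifs with h <;> simp [h]

theorem egfCoeff_expSeries_pow {T : PowerSeries ℚ} (hT0 : constantCoeff T = 0)
    (hT : T = X * expSeries T) (m a : ℕ) :
    egfCoeff m (expSeries T ^ a) = rootedForestCount a m := by
  induction m using Nat.strong_induction_on generalizing a with
  | _ m ih =>
  have hexp : expSeries T ^ a = expSeries (C (a : ℚ) * X * expSeries T) * 1 := by
    rw [mul_assoc, ← hT, mul_one, map_natCast, expSeries_natCast_mul hT0]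
  rw [hexp, expSeries, egfCoeff_subst_mul, rootedForestCount_eq_sum a m]
  push_cast
  refine Finset.sum_congr rfl fun k hk => ?_
  rw [egfCoeff_exp, one_mul, mul_one]
  rcases Nat.eq_zero_or_pos k with rfl | hk0
  · rw [pow_zero (expSeries T), egfCoeff_one]
  · rw [Finset.mem_range] at hk
    rw [ih (m - k) (by omega)]

theorem rescale_lambertW_of_eq {T : PowerSeries ℚ} (hT0 : constantCoeff T = 0)
    (hT : T = X * expSeries T) : rescale (-1) lambertW = -T := by
  ext m
  rw [map_neg, coeff_rescale, lambertW, coeff_mk]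
  rcases m with _ | m
  · simpa using hT0
  · have hcoeff : egfCoeff (m + 1) T = (m + 1 : ℚ) ^ m := by
      rw [hT, egfCoeff_X_mul, Nat.add_sub_cancel, ← pow_one (expSeries T),
        egfCoeff_expSeries_pow hT0 hT, rootedForestCount]
      rcases m with _ | m
      · simp
      · rw [if_neg (Nat.succ_ne_zero m), Nat.add_sub_cancel]
        push_cast
        ring
    have hf : ((m + 1)! : ℚ) ≠ 0 := Nat.cast_ne_zero.2 (Nat.factorial_ne_zero _)
    have hsign : (-1 : ℚ) ^ (m + 1) * (-1) ^ m = -1 := by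
      rw [pow_succ, mul_right_comm, ← mul_pow]; simp
    rw [egfCoeff_apply] at hcoeff
    rw [if_neg (Nat.succ_ne_zero m), Nat.add_sub_cancel, neg_pow ((m + 1 : ℕ) : ℚ),
      ← mul_div_assoc, ← mul_assoc, hsign, div_eq_iff hf]
    push_cast
    linear_combination hcoeff

/-- The exponential generating function of rooted trees in which every edge has weight `t`, that is
`∑_{n ≥ 1} (t n) ^ (n - 1) x ^ n / n! = -W(-t x) / t`. The encoding avoids the division by `t`. -/
noncomputable def treeSeries (t : ℚ) : PowerSeries ℚ := X * expSeries (-lambertWScaled (-t))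

theorem lambertWScaled_neg (t : ℚ) : lambertWScaled (-t) = -(C t * treeSeries t) := by
  obtain ⟨T, hT0, hT⟩ := exists_eq_X_mul_expSeries
  have h : lambertWScaled (-t) = -rescale t T := by
    rw [← map_neg, ← rescale_lambertW_of_eq hT0 hT, rescale_rescale, lambertWScaled, neg_one_mul]
  rw [treeSeries, h, neg_neg, ← rescale_expSeries t hT0, ← mul_assoc, ← rescale_X, ← map_mul, ← hT]

theorem constantCoeff_treeSeries (t : ℚ) : constantCoeff (treeSeries t) = 0 := by
  rw [treeSeries, map_mul, constantCoeff_X, zero_mul]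

theorem constantCoeff_C_mul_treeSeries (c t : ℚ) : constantCoeff (C c * treeSeries t) = 0 := by
  rw [map_mul, constantCoeff_treeSeries, mul_zero]

theorem treeSeries_eq (t : ℚ) : treeSeries t = X * expSeries (C t * treeSeries t) := by
  conv_lhs => rw [treeSeries, lambertWScaled_neg, neg_neg]

theorem one_sub_mul_derivative_treeSeries (t : ℚ) :
    (1 - C t * treeSeries t) * d⁄dX ℚ (treeSeries t) = expSeries (C t * treeSeries t) := by
  have h := congrArg (d⁄dX ℚ) (treeSeries_eq t)
  rw [Derivation.leibniz, derivative_X, derivative_expSeries (constantCoeff_C_mul_treeSeries t t),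
    Derivation.leibniz, derivative_C] at h
  simp only [smul_eq_mul] at h
  linear_combination h - C t * d⁄dX ℚ (treeSeries t) * treeSeries_eq t

end TreeSeries

/-! ## Generating functions of the counts -/

section GeneratingFunctions

open PowerSeries

/-- The exponential generating function of the numbers `starCountA t m 0`. -/
noncomputable def typeASeries (t : ℚ) : PowerSeries ℚ :=
  expSeries (treeSeries t - C (t / 2) * treeSeries t ^ 2)

theorem constantCoeff_typeASeries (t : ℚ) : constantCoeff (typeASeries t) = 1 :=
  constantCoeff_expSeries (by simp [constantCoeff_treeSeries])

theorem derivative_typeASeries (t : ℚ) :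
    d⁄dX ℚ (typeASeries t) = expSeries (C t * treeSeries t) * typeASeries t := by
  have ht : C (t / 2) * 2 = (C t : PowerSeries ℚ) := by
    rw [← map_ofNat (C : ℚ →+* PowerSeries ℚ) 2, ← map_mul, div_mul_cancel₀ t two_ne_zero]
  rw [typeASeries, derivative_expSeries (by simp [constantCoeff_treeSeries]), map_sub,
    Derivation.leibniz, derivative_C, derivative_pow, smul_eq_mul, smul_eq_mul]
  push_cast
  linear_combination expSeries (treeSeries t - C (t / 2) * treeSeries t ^ 2) *
    (one_sub_mul_derivative_treeSeries t - treeSeries t * d⁄dX ℚ (treeSeries t) * ht)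

theorem starCountA_eq_egfCoeff (t : ℚ) (m : ℕ) (c : ℚ) :
    starCountA t m c = egfCoeff m (expSeries (C c * treeSeries t) * typeASeries t) := by
  induction m using Nat.strong_induction_on generalizing c with
  | _ m ih =>
  set u := expSeries (C t * treeSeries t) with hu
  have hpow (k : ℕ) : u ^ k = expSeries (C (k * t) * treeSeries t) := by
    rw [hu, ← expSeries_natCast_mul (constantCoeff_C_mul_treeSeries t t), map_mul, map_natCast,
      mul_assoc]
  have hexp : expSeries (C c * treeSeries t) =
      expSeries (C c * X * u) * (1 + C c * X * u * 0 + (C c * X * u) ^ 2 * 0) := by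
    rw [mul_zero, mul_zero, add_zero, add_zero, mul_one, mul_assoc, ← treeSeries_eq]
  rw [hexp, egfCoeff_expSeries_mul]
  simp only [mul_zero, add_zero, one_mul]
  cases m with
  | zero =>
    simp [starCountA, egfCoeff_zero, constantCoeff_typeASeries]
  | succ m =>
    rw [starCountA, add_comm (starCountA t m t), Finset.sum_range_succ' _ (m + 1),
      ih m (Nat.lt_succ_self m)]
    refine congrArg₂ (· + ·) (Finset.sum_congr rfl fun k _ => ?_) ?_
    · rw [ih (m - k) (by omega), hpow, Nat.add_sub_add_right]
    · rw [Nat.choose_zero_right, Nat.cast_one, pow_zero, pow_zero, one_mul, one_mul, one_mul,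
        Nat.sub_zero, egfCoeff_succ, derivative_typeASeries]

theorem egfAt_ehrhartA (t : ℚ) : egfAt ehrhartA t = typeASeries t :=
  egfAt_eq_of_eval fun n => by
    rw [eval_ehrhartA, starCountA_eq_egfCoeff, map_zero, zero_mul, expSeries_zero, one_mul]

theorem typeASeries_eq {t : ℚ} (ht : t ≠ 0) :
    typeASeries t =
      expSeries (-(1 / t) • lambertWScaled (-t) - (1 / (2 * t)) • lambertWScaled (-t) ^ 2) := by
  have hlinear : C (1 / t) * C t = (1 : PowerSeries ℚ) := by
    rw [← map_mul, one_div_mul_cancel ht, map_one]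
  have hquadratic : C (1 / (2 * t)) * C t ^ 2 = (C (t / 2) : PowerSeries ℚ) := by
    rw [← map_pow, ← map_mul]
    congr 1
    field_simp
  rw [typeASeries, lambertWScaled_neg, smul_eq_C_mul, smul_eq_C_mul, map_neg]
  congr 1
  linear_combination treeSeries t ^ 2 * hquadratic - treeSeries t * hlinear

/-- The exponential generating function of the numbers `starCountB t m 0 h`. -/
noncomputable def typeBSeries (t h : ℚ) : PowerSeries ℚ :=
  expSeries (C (1 + h - t) * treeSeries (2 * t) - C t * treeSeries (2 * t) ^ 2) *
    (sqrtOneAdd (-(C (2 * t) * treeSeries (2 * t))))⁻¹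

/-- Twice the exponential generating function of trees with two marked vertices, possibly equal, in
which every edge has weight `2 t`. -/
noncomputable def birootedTreeSeries (t : ℚ) : PowerSeries ℚ :=
  2 * treeSeries (2 * t) * (1 - C (2 * t) * treeSeries (2 * t))⁻¹

/-- The factor contributed by the component of the star center, without the exponential of the
trees attached to it. -/
noncomputable def starFactorB (t c h : ℚ) : PowerSeries ℚ :=
  1 + C c * birootedTreeSeries t * (C h + C t ^ 2 * birootedTreeSeries t) +
    C c ^ 2 * birootedTreeSeries t

theorem birootedTreeSeries_eq (t : ℚ) :
    birootedTreeSeries t = 2 * treeSeries (2 * t) * (1 + C t * birootedTreeSeries t) := by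
  have hinv : (1 - C (2 * t) * treeSeries (2 * t))⁻¹ * (1 - C (2 * t) * treeSeries (2 * t)) = 1 :=
    PowerSeries.inv_mul_cancel _ (by simp [constantCoeff_treeSeries])
  have htwo : C (2 * t) = (2 * C t : PowerSeries ℚ) := by rw [map_mul, map_ofNat]
  rw [birootedTreeSeries]
  linear_combination 2 * treeSeries (2 * t) * (hinv +
    (1 - C (2 * t) * treeSeries (2 * t))⁻¹ * treeSeries (2 * t) * htwo)

theorem one_add_birootedTreeSeries_mul_one_sub (t : ℚ) :
    (1 + C t * birootedTreeSeries t) * (1 - C (2 * t) * treeSeries (2 * t)) = 1 := by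
  rw [map_mul, map_ofNat]
  linear_combination C t * birootedTreeSeries_eq t

theorem derivative_treeSeries_two_mul (t : ℚ) :
    d⁄dX ℚ (treeSeries (2 * t)) =
      expSeries (C (2 * t) * treeSeries (2 * t)) * (1 + C t * birootedTreeSeries t) := by
  linear_combination
    (1 + C t * birootedTreeSeries t) * one_sub_mul_derivative_treeSeries (2 * t) -
      d⁄dX ℚ (treeSeries (2 * t)) * one_add_birootedTreeSeries_mul_one_sub t

theorem constantCoeff_birootedTreeSeries (t : ℚ) : constantCoeff (birootedTreeSeries t) = 0 := by
  rw [birootedTreeSeries, map_mul, map_mul, constantCoeff_treeSeries, mul_zero, zero_mul]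

theorem constantCoeff_starFactorB (t c h : ℚ) : constantCoeff (starFactorB t c h) = 1 := by
  simp [starFactorB, constantCoeff_birootedTreeSeries]

theorem starFactorB_zero (t h : ℚ) : starFactorB t 0 h = 1 := by
  simp [starFactorB]

theorem constantCoeff_typeBSeries (t h : ℚ) : constantCoeff (typeBSeries t h) = 1 := by
  rw [typeBSeries, map_mul, constantCoeff_expSeries (by simp [constantCoeff_treeSeries]),
    constantCoeff_inv, constantCoeff_sqrtOneAdd (by simp [constantCoeff_treeSeries]), inv_one,
    one_mul]

theorem typeBSeries_add (t h : ℚ) (k : ℕ) :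
    typeBSeries t (h + 2 * (k * t)) =
      expSeries (C (2 * t) * treeSeries (2 * t)) ^ k * typeBSeries t h := by
  rw [typeBSeries, typeBSeries, ← expSeries_natCast_mul (constantCoeff_C_mul_treeSeries _ _),
    ← mul_assoc (expSeries _), ← expSeries_add (by simp [constantCoeff_treeSeries])
      (by simp [constantCoeff_treeSeries])]
  congr 2
  simp only [map_add, map_sub, map_mul, map_one, map_ofNat, map_natCast]
  ring

theorem derivative_inv_sqrtOneAdd_treeSeries (t : ℚ) :
    d⁄dX ℚ (sqrtOneAdd (-(C (2 * t) * treeSeries (2 * t))))⁻¹ =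
      C t * expSeries (C (2 * t) * treeSeries (2 * t)) * (1 + C t * birootedTreeSeries t) ^ 2 *
        (sqrtOneAdd (-(C (2 * t) * treeSeries (2 * t))))⁻¹ := by
  have hhalf : C (1 / 2 : ℚ) * C (2 * t) = (C t : PowerSeries ℚ) := by
    rw [← map_mul]
    congr 1
    ring
  rw [derivative_inv_sqrtOneAdd (v := 1 + C t * birootedTreeSeries t)
    (by simp [constantCoeff_treeSeries])
    (by rw [← sub_eq_add_neg, one_add_birootedTreeSeries_mul_one_sub]), map_neg, Derivation.leibniz,
    derivative_C, derivative_treeSeries_two_mul, smul_zero, add_zero, smul_eq_mul]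
  linear_combination expSeries (C (2 * t) * treeSeries (2 * t)) *
    (1 + C t * birootedTreeSeries t) ^ 2 *
    (sqrtOneAdd (-(C (2 * t) * treeSeries (2 * t))))⁻¹ * hhalf

theorem derivative_typeBSeries (t h : ℚ) :
    d⁄dX ℚ (typeBSeries t h) =
      expSeries (C (2 * t) * treeSeries (2 * t)) * (starFactorB t t h + C h) * typeBSeries t h := by
  rw [typeBSeries, Derivation.leibniz, derivative_expSeries (by simp [constantCoeff_treeSeries]),
    derivative_inv_sqrtOneAdd_treeSeries]
  simp only [map_sub, Derivation.leibniz, derivative_C, derivative_pow, smul_eq_mul,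
    derivative_treeSeries_two_mul, starFactorB, map_add, map_one, derivative_one]
  push_cast
  set q := treeSeries (2 * t)
  set r := (sqrtOneAdd (-(C (2 * t) * q)))⁻¹
  linear_combination C t * expSeries (C (2 * t) * q) * r *
    expSeries ((1 + C h - C t) * q - C t * q ^ 2) * birootedTreeSeries_eq t

theorem starFactorB_eq (t c h : ℚ) :
    starFactorB t c h =
      1 + C (2 * c) * treeSeries (2 * t) *
          (C t * birootedTreeSeries t * (C h + C t ^ 2 * birootedTreeSeries t) +
            C t ^ 2 * birootedTreeSeries t + C h + C c) +
        (C (2 * c) * treeSeries (2 * t)) ^ 2 * (C t ^ 2 * birootedTreeSeries t + C t) := by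
  rw [starFactorB, map_mul, map_ofNat]
  linear_combination (C c * (C h + C t ^ 2 * birootedTreeSeries t) +
    C c ^ 2 * (1 + 2 * C t * treeSeries (2 * t))) * birootedTreeSeries_eq t

theorem starFactorB_natCast_mul (t c h : ℚ) (k : ℕ) :
    1 + C (k : ℚ) * (C t * birootedTreeSeries t * (C h + C t ^ 2 * birootedTreeSeries t) +
          C t ^ 2 * birootedTreeSeries t + C h + C c) +
        C ((k : ℚ) * (k - 1)) * (C t ^ 2 * birootedTreeSeries t + C t) =
      starFactorB t (k * t) h + C (2 * t * (k.choose 2 : ℕ) + h * k + c * k) := by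
  rw [starFactorB, Nat.cast_choose_two,
    show 2 * t * (k * (k - 1) / 2) + h * k + c * k = t * (k * (k - 1)) + h * k + c * k by ring]
  simp only [map_add, map_sub, map_mul, map_one, map_natCast]
  ring

theorem egfCoeff_starSeriesB (t c h : ℚ) (m : ℕ) :
    egfCoeff m (expSeries (C (2 * c) * treeSeries (2 * t)) * starFactorB t c h * typeBSeries t h) =
      ∑ k ∈ Finset.range (m + 1), (m.choose k : ℚ) * ((2 * c) ^ k *
        (egfCoeff (m - k) (expSeries (C (2 * (k * t)) * treeSeries (2 * t)) *
            starFactorB t (k * t) h * typeBSeries t h) +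
          (2 * t * (k.choose 2 : ℕ) + h * k + c * k) *
            egfCoeff (m - k) (typeBSeries t (h + 2 * (k * t))))) := by
  set u := expSeries (C (2 * t) * treeSeries (2 * t)) with hu
  have hpow (k : ℕ) : expSeries (C (2 * (k * t)) * treeSeries (2 * t)) = u ^ k := by
    rw [hu, ← expSeries_natCast_mul (constantCoeff_C_mul_treeSeries _ _), mul_left_comm 2, map_mul,
      map_natCast, mul_assoc]
  have hy : C (2 * c) * treeSeries (2 * t) = C (2 * c) * X * u := by
    rw [mul_assoc, hu, ← treeSeries_eq]
  rw [starFactorB_eq, hy, egfCoeff_expSeries_mul]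
  refine Finset.sum_congr rfl fun k _ => ?_
  rw [starFactorB_natCast_mul, hpow, typeBSeries_add, ← egfCoeff_C_mul (c := _ + _ + _),
    ← map_add (egfCoeff _)]
  congr 3
  ring

theorem starCountB_eq_egfCoeff (t : ℚ) (m : ℕ) (c h : ℚ) :
    starCountB t m c h =
      egfCoeff m (expSeries (C (2 * c) * treeSeries (2 * t)) * starFactorB t c h *
        typeBSeries t h) := by
  induction m using Nat.strong_induction_on generalizing c h with
  | _ m ih =>
  have hzero {j : ℕ} (hj : j < m) (h : ℚ) : starCountB t j 0 h = egfCoeff j (typeBSeries t h) := by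
    rw [ih j hj, starFactorB_zero, mul_zero, map_zero, zero_mul, expSeries_zero, one_mul, one_mul]
  cases m with
  | zero =>
    simp [starCountB, egfCoeff_zero, constantCoeff_typeBSeries, constantCoeff_starFactorB,
      constantCoeff_expSeries, constantCoeff_treeSeries]
  | succ m =>
    have hderiv : starCountB t m t h + h * starCountB t m 0 (h + 2 * t) =
        egfCoeff (m + 1) (typeBSeries t h) := by
      have hadd := typeBSeries_add t h 1
      rw [Nat.cast_one, one_mul, pow_one] at hadd
      rw [ih m (Nat.lt_succ_self m), hzero (Nat.lt_succ_self m), hadd, egfCoeff_succ,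
        derivative_typeBSeries, ← egfCoeff_C_mul, ← map_add]
      congr 1
      ring
    rw [starCountB, hderiv, add_comm (egfCoeff _ _), egfCoeff_starSeriesB,
      Finset.sum_range_succ' _ (m + 1)]
    refine congrArg₂ (· + ·) (Finset.sum_congr rfl fun k _ => ?_) ?_
    · rw [ih (m - k) (by omega), hzero (by omega), Nat.add_sub_add_right]
    · simp [starFactorB_zero, expSeries_zero]

theorem egfAt_ehrhartB (a : ℕ) (t : ℚ) : egfAt (ehrhartB a) t = typeBSeries t (a * t) :=
  egfAt_eq_of_eval fun n => by
    rw [eval_ehrhartB, starCountB_eq_egfCoeff, starFactorB_zero, mul_zero, map_zero, zero_mul,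
      expSeries_zero, one_mul, one_mul]

theorem typeBSeries_eq {t : ℚ} (ht : t ≠ 0) (h : ℚ) :
    typeBSeries t h =
      expSeries (((t - h - 1) / (2 * t)) • lambertWScaled (-2 * t)
        - (1 / (4 * t)) • lambertWScaled (-2 * t) ^ 2)
        * (sqrtOneAdd (lambertWScaled (-2 * t)))⁻¹ := by
  have hlinear : C ((t - h - 1) / (2 * t)) * C (2 * t) = (-C (1 + h - t) : PowerSeries ℚ) := by
    rw [← map_mul, div_mul_cancel₀ _ (mul_ne_zero two_ne_zero ht), ← map_neg]
    congr 1
    ring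
  have hquadratic : C (1 / (4 * t)) * C (2 * t) ^ 2 = (C t : PowerSeries ℚ) := by
    rw [← map_pow, ← map_mul]
    congr 1
    field_simp
    norm_num
  rw [typeBSeries, neg_mul, lambertWScaled_neg, smul_eq_C_mul, smul_eq_C_mul]
  congr 2
  linear_combination treeSeries (2 * t) * hlinear + treeSeries (2 * t) ^ 2 * hquadratic

end GeneratingFunctions

theorem theorem5p2 :
    ∃ ehrA ehrB ehrC ehrD : ℕ → Polynomial ℚ,
      (∀ n : ℕ,
        IsEhrhartPolynomial (integralCoxeterPermutahedron (positiveRootsA n)) (ehrA n) ∧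
        IsEhrhartPolynomial (integralCoxeterPermutahedron (positiveRootsB n)) (ehrB n) ∧
        IsEhrhartPolynomial (integralCoxeterPermutahedron (positiveRootsC n)) (ehrC n) ∧
        IsEhrhartPolynomial (integralCoxeterPermutahedron (positiveRootsD n)) (ehrD n)) ∧
      ∀ t : ℚ, t ≠ 0 →
        egfAt ehrA t =
          expSeries (-(1 / t) • lambertWScaled (-t)
            - (1 / (2 * t)) • lambertWScaled (-t) ^ 2) ∧
        egfAt ehrB t =
          expSeries (-(1 / (2 * t)) • lambertWScaled (-2 * t)
            - (1 / (4 * t)) • lambertWScaled (-2 * t) ^ 2)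
            * (sqrtOneAdd (lambertWScaled (-2 * t)))⁻¹ ∧
        egfAt ehrC t =
          expSeries (((-t - 1) / (2 * t)) • lambertWScaled (-2 * t)
            - (1 / (4 * t)) • lambertWScaled (-2 * t) ^ 2)
            * (sqrtOneAdd (lambertWScaled (-2 * t)))⁻¹ ∧
        egfAt ehrD t =
          expSeries (((t - 1) / (2 * t)) • lambertWScaled (-2 * t)
            - (1 / (4 * t)) • lambertWScaled (-2 * t) ^ 2)
            * (sqrtOneAdd (lambertWScaled (-2 * t)))⁻¹ := by
  refine ⟨ehrhartA, ehrhartB 1, ehrhartB 2, ehrhartB 0, fun n => ⟨isEhrhartPolynomial_ehrhartA n,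
    isEhrhartPolynomial_ehrhartB 1 ?_, isEhrhartPolynomial_ehrhartB 2 (sum_positiveRootsC n),
    isEhrhartPolynomial_ehrhartB 0 ?_⟩, fun t ht => ⟨?_, ?_, ?_, ?_⟩⟩
  · rw [sum_positiveRootsB, one_smul]
  · rw [sum_positiveRootsD, zero_smul, add_zero]
  · rw [egfAt_ehrhartA, typeASeries_eq ht]
  all_goals
    rw [egfAt_ehrhartB, typeBSeries_eq ht]
    congr 4
    push_cast
    ring
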